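/- **Setting.** All machine sizes are powers of two. $M(q)$ has processing elements $P_0,\dots,P_{q-1}$ with unbounded local memories. A static algorithm on $M(q)$ is a sequence of supersteps with labels $i\in\{0,\dots,\log_2 q-1\}$ (an $i$-superstep ends with a barrier within each set of processing elements whose indices share the $i$ most significant bits, and messages are exchanged only within these sets); the labels and the source–destination pairs of the messages depend only on the input size $n$. *Folding* onto $M(q')$, $q'<q$, lets $P_j$ of $M(q')$ carry out the operations of the $q/q'$ consecutive processing elements starting with $P_{j(q/q')}$; supersteps with label $\ge\log_2 q'$ become local computation. Let $S^i$ be the number of $i$-supersteps and $F^i$ the sum of their degrees, where the degree of a superstep is the maximum number of messages sent to, or received from, other processing elements by any processing element. On the machine D-BSP$(p,\mathbf g,\boldsymbol\ell)$, with $\mathbf g=(g_0,\dots,g_{\log_2 p-1})$, $\boldsymbol\ell=(\ell_0,\dots,\ell_{\log_2 p-1})$, $g_i>0$, $\ell_i\ge 0$, the communication time of an algorithm $\mathcal A$ for $M(p)$ is $$D_{\mathcal A}(n,p,\mathbf g,\boldsymbol\ell)=\sum_{i=0}^{\log_2 p-1}\bigl(F^i_{\mathcal A}\,g_i+S^i_{\mathcal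 A}\,\ell_i\bigr).$$ **Problem and class.** The $n$-input FFT DAG ($n$ a power of two) has vertices $\langle w,l\rangle$, $0\le w<n$, $0\le l\le\log_2 n$, and an arc from $\langle w,l\rangle$ to $\langle w',l+1\rangle$ iff $w=w'$ or $w,w'$ differ exactly in the $l$-th bit (bit $0$ being the least significant); the vertices with $l=0$ are the inputs. Fix $\varepsilon$ with $1/2\le\varepsilon<1$. Let $\mathscr C$ be the class of static algorithms that evaluate this DAG (a processing element evaluates a vertex when it holds the values of its predecessors in its memory; a message carries at most one vertex value), such that for $q$ processing elements: (i) every non-input vertex is evaluated exactly once; (ii) every input is initially stored at exactly one processing element; (iii) no processing element evaluates more than $\varepsilon n\log_2 n$ vertices; (iv) all foldings on $q'$ processing elements, $2\le q'<q$, also belong to $\mathscr C$. **Algorithm.** Let $n=2^{2^k}$, $k\ge0$. The network-oblivious FFT algorithm is specified on $M(n)$, with virtual processors $VP_0,\dots,VP_{n-1}$; initially $VP_r$ holds the $r$-th input. To compute an $N$-input subDAG in a segment of $N=n^{1/2^i}>2$ consecutive virtual processors, each of its $\sqrt N$ sub-segments of $\sqrt N$ consecutive virtual processors recursively computes a $\sqrt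 N$-input subDAG; then the values held by the segment are permuted as in the transposition of a $\sqrt N\times\sqrt N$ row-major matrix in one superstep with label $(1-1/2^i)\log_2 n$; then each sub-segment recursively computes a $\sqrt N$-input subDAG of the second set. A segment with $N=2$ uses two supersteps with label $\log_2 n-1$: its virtual processors exchange their values, then each evaluates one vertex. In addition, in every superstep with label $(1-1/2^i)\log_2 n$, $VP_j$ sends a dummy message to $VP_{j+n^{1/2^i}/2}$, for $0\le j<n^{1/2^i}/2$. **Claim.** The algorithm is $\Theta(1)$-optimal with respect to $\mathscr C$ on every D-BSP$(p,\mathbf g,\boldsymbol\ell)$ with $1<p\le n$, non-increasing $g_i$ and $\ell_i/g_i$, and $\ell_0/g_0=O(n/p)$. That is, for every $\varepsilon\in[1/2,1)$ and every real $c$ there is a constant $\beta\in(0,1]$, depending only on $\varepsilon$ and $c$, such that for all $k\ge 0$, $n=2^{2^k}$, all powers of two $p$ with $1<p\le n$, and all $\mathbf g,\boldsymbol\ell$ with $g_i>0$, $\ell_i\ge0$, $g_i\ge g_{i+1}$, $\ell_i/g_i\ge\ell_{i+1}/g_{i+1}$ and $\ell_0/g_0\le c\,n/p$: the folding $\mathcal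 A$ of the algorithm on $p$ processors belongs to $\mathscr C$, and $$D_{\mathcal A}(n,p,\mathbf g,\boldsymbol\ell)\le\frac1\beta\,D_{\mathcal B}(n,p,\mathbf g,\boldsymbol\ell)$$ for every algorithm $\mathcal B\in\mathscr C$ for $p$ processing elements. -/

import Mathlib

namespace FFTNet

/-! ### The FFT DAG

Sizes are powers of two and are given by their binary logarithms: `m = log n` for the number `n`
of inputs, `a = log q` for the number `q` of processing elements. -/

/-- Vertices of the `2 ^ m`-input FFT DAG: a pair `(w, l)` with `0 ≤ w < 2 ^ m`, `0 ≤ l ≤ m`.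
The vertices with `l = 0` are the inputs, those with `l = m` are the outputs. -/
abbrev Node (m : ℕ) : Type := Fin (2 ^ m) × Fin (m + 1)

/-- There is an arc from `(w, l)` to `(w', l')` iff `l' = l + 1` and `w`, `w'` are identical or
their binary representations differ exactly in the `l`-th bit. -/
def Arc {m : ℕ} (u v : Node m) : Prop :=
  (v.2 : ℕ) = (u.2 : ℕ) + 1 ∧
    (u.1 = v.1 ∨ (u.1 : ℕ) ^^^ (v.1 : ℕ) = 2 ^ (u.2 : ℕ))

/-! ### Static algorithms on `M(2 ^ a)` that evaluate the FFT DAG -/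

/-- A constant-size message: it carries the value of one DAG vertex, or is a dummy (`none`). -/
structure Message (m a : ℕ) where
  src : Fin (2 ^ a)
  dst : Fin (2 ^ a)
  payload : Option (Node m)

/-- A superstep: every processing element first evaluates some vertices (`(P, v) ∈ evals` means
that `P` evaluates `v`), then sends some messages, and then performs `sync(label)`, after which
the messages are available at their destinations.

If `label ≥ a`, the `label`-clusters of `M(2 ^ a)` are single processing elements, nothing is
synchronized, and the record describes mere local computation (this is what a superstep of a
larger machine turns into under folding). -/
structure Superstep (m a : ℕ) where
  label : ℕ
  evals : Multiset (Fin (2 ^ a) × Node m)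
  msgs : Multiset (Message m a)

/-- A static algorithm for the FFT DAG: the initial distribution of the inputs (`(P, w)` means
that the `w`-th input is initially stored at `P`) and the sequence of supersteps. -/
structure Algorithm (m a : ℕ) where
  inputs : Multiset (Fin (2 ^ a) × Fin (2 ^ m))
  steps : List (Superstep m a)

namespace Superstep

variable {m a : ℕ}

/-- Contents of the local memories after the evaluations of `s`; `(P, v) ∈ M` means that `P`
knows the value of `v`. -/
def afterEvals (s : Superstep m a) (M : Set (Fin (2 ^ a) × Node m)) :
    Set (Fin (2 ^ a) × Node m) :=
  M ∪ {e | e ∈ s.evals}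

/-- Contents of the local memories after the barrier that ends `s`. -/
def afterSync (s : Superstep m a) (M : Set (Fin (2 ^ a) × Node m)) :
    Set (Fin (2 ^ a) × Node m) :=
  s.afterEvals M ∪ {e | ∃ μ ∈ s.msgs, μ.dst = e.1 ∧ μ.payload = some e.2}

/-- `s` can be executed when the local memories contain `M`. -/
structure Legal (s : Superstep m a) (M : Set (Fin (2 ^ a) × Node m)) : Prop where
  /-- A processing element evaluates a vertex only if it knows the values of all predecessors. -/
  operands : ∀ e ∈ s.evals, ∀ u : Node m, Arc u e.2 → (e.1, u) ∈ s.afterEvals M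
  /-- Only known values can be sent. -/
  payloads : ∀ μ ∈ s.msgs, ∀ u : Node m, μ.payload = some u → (μ.src, u) ∈ s.afterEvals M
  /-- Messages stay within clusters: source and destination share the `label` most significant
  of their `a` bits. -/
  clusters : ∀ μ ∈ s.msgs,
    (μ.src : ℕ) / 2 ^ (a - s.label) = (μ.dst : ℕ) / 2 ^ (a - s.label)

/-- Number of messages that `P` sends to other processing elements. -/
def sent (s : Superstep m a) (P : Fin (2 ^ a)) : ℕ :=
  s.msgs.countP fun μ => μ.src = P ∧ μ.dst ≠ P

/-- Number of messages that `P` is sent by other processing elements. -/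
def received (s : Superstep m a) (P : Fin (2 ^ a)) : ℕ :=
  s.msgs.countP fun μ => μ.dst = P ∧ μ.src ≠ P

/-- The degree `h` of a superstep. -/
def degree (s : Superstep m a) : ℕ :=
  Finset.univ.sup fun P => max (s.sent P) (s.received P)

end Superstep

/-- The supersteps of the list can be executed one after the other, starting from memories `M`. -/
def LegalFrom {m a : ℕ} : Set (Fin (2 ^ a) × Node m) → List (Superstep m a) → Prop
  | _, [] => True
  | M, s :: L => s.Legal M ∧ LegalFrom (s.afterSync M) L

/-- The processor of `M(2 ^ b)` that carries out the operations of processing element `r` of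
`M(2 ^ a)` under folding: each one simulates `2 ^ a / 2 ^ b` consecutively numbered ones. -/
def foldIdx {a b : ℕ} (h : b ≤ a) (r : Fin (2 ^ a)) : Fin (2 ^ b) :=
  ⟨(r : ℕ) / 2 ^ (a - b), Nat.div_lt_of_lt_mul (by
    have hr := r.isLt
    rwa [← pow_add, Nat.sub_add_cancel h])⟩

namespace Algorithm

variable {m a : ℕ}

/-- The folding of an algorithm for `M(2 ^ a)` on the smaller machine `M(2 ^ b)`. -/
def fold (A : Algorithm m a) {b : ℕ} (h : b ≤ a) : Algorithm m b where
  inputs := A.inputs.map fun e => (foldIdx h e.1, e.2)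
  steps := A.steps.map fun s =>
    { label := s.label
      evals := s.evals.map fun e => (foldIdx h e.1, e.2)
      msgs := s.msgs.map fun μ => ⟨foldIdx h μ.src, foldIdx h μ.dst, μ.payload⟩ }

/-- Initial contents of the local memories. -/
def initialMemory (A : Algorithm m a) : Set (Fin (2 ^ a) × Node m) :=
  {e | ∃ w, (e.1, w) ∈ A.inputs ∧ e.2 = (w, 0)}

/-- All evaluations performed by the algorithm. -/
def evals (A : Algorithm m a) : Multiset (Fin (2 ^ a) × Node m) :=
  (A.steps.map Superstep.evals).sum

/-- Number of `i`-supersteps. -/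
def numSteps (A : Algorithm m a) (i : ℕ) : ℕ :=
  (A.steps.filter fun s => s.label = i).length

/-- Cumulative degree of the `i`-supersteps. -/
def cumDegree (A : Algorithm m a) (i : ℕ) : ℕ :=
  ((A.steps.filter fun s => s.label = i).map Superstep.degree).sum

/-- Communication time on the D-BSP with `2 ^ a` processors and parameter vectors `g` and `ℓ`. -/
noncomputable def commTime (A : Algorithm m a) (g ℓ : Fin a → ℝ) : ℝ :=
  ∑ i : Fin a, ((A.cumDegree i : ℝ) * g i + (A.numSteps i : ℝ) * ℓ i)

end Algorithm

/-- The requirements on an algorithm of the class, except for closure under folding. -/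
structure Admissible (ε : ℝ) {m a : ℕ} (A : Algorithm m a) : Prop where
  /-- The schedule is executable. -/
  legal : LegalFrom A.initialMemory A.steps
  /-- Input vertices are given, not evaluated. -/
  input_nodes : ∀ e ∈ A.evals, e.2.2 ≠ 0
  /-- Each other vertex of the DAG is evaluated exactly once. -/
  eval_once : ∀ v : Node m, v.2 ≠ 0 → A.evals.countP (fun e => e.2 = v) = 1
  /-- Each input is initially stored at exactly one processing element. -/
  input_once : ∀ w : Fin (2 ^ m), A.inputs.countP (fun e => e.2 = w) = 1
  /-- No processing element evaluates more than `ε n log n` vertices. -/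
  load : ∀ P : Fin (2 ^ a),
    (A.evals.countP (fun e => e.1 = P) : ℝ) ≤ ε * ((2 : ℝ) ^ m * (m : ℝ))

/-- The class `𝒞`: admissible algorithms all of whose foldings on `q'` processing elements,
`2 ≤ q' < q`, belong to `𝒞` as well. -/
inductive InClass (ε : ℝ) {m : ℕ} : {a : ℕ} → Algorithm m a → Prop
  | intro {a : ℕ} (A : Algorithm m a) (adm : Admissible ε A)
      (folds : ∀ (b : ℕ) (h : b < a), 1 ≤ b → InClass ε (A.fold h.le)) : InClass ε A

/-- For inputs of size `2 ^ m`, the algorithm `B` is `β`-optimal with respect to the class on the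
D-BSP with `2 ^ a` processors and parameter vectors `g` and `ℓ`. -/
def IsOptimal (β ε : ℝ) {m a : ℕ} (g ℓ : Fin a → ℝ) (B : Algorithm m a) : Prop :=
  InClass ε B ∧
    ∀ B' : Algorithm m a, InClass ε B' → B.commTime g ℓ ≤ 1 / β * B'.commTime g ℓ

/-! ### The network-oblivious FFT algorithm

It is specified on `M(n)` with `n = 2 ^ 2 ^ k`. All segments of `2 ^ 2 ^ j` consecutively
numbered virtual processors proceed in parallel and in the same way, hence each superstep below
describes all `n` virtual processors. `W r` is the wire (first component of the vertex) whose
current value is held by virtual processor `r`, and `l` is the current level, so that `r` holds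
the value of the vertex `(W r, l)`. -/

/-- Virtual processors of `M(2 ^ 2 ^ k)`. -/
abbrev VP (k : ℕ) : Type := Fin (2 ^ 2 ^ k)

/-- The vertex on wire `w` at level `l ≤ 2 ^ k`. -/
def node (k : ℕ) (w : VP k) (l : ℕ) : Node (2 ^ k) := (w, Fin.ofNat (2 ^ k + 1) l)

/-- Neighbour of `r` in its segment of two virtual processors. -/
def partner (k : ℕ) (r : VP k) : VP k := Fin.ofNat (2 ^ 2 ^ k) ((r : ℕ) ^^^ 1)

/-- Transposition of an `s × s` matrix stored in row-major order, within each segment of `s * s`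
consecutive indices. -/
def transposeNat (s r : ℕ) : ℕ := r / (s * s) * (s * s) + r % s * s + r % (s * s) / s

/-- The transposition pattern within segments of `2 ^ 2 ^ (j + 1)` virtual processors
(`j + 1 ≤ k`; reduction modulo the number of virtual processors then has no effect). -/
def transpose (k j : ℕ) (r : VP k) : VP k :=
  Fin.ofNat (2 ^ 2 ^ k) (transposeNat (2 ^ 2 ^ j) r)

/-- The label `log n - 2 ^ j = (1 - 1 / 2 ^ i) log n`, `i = k - j`, of supersteps within segments
of `2 ^ 2 ^ j = n ^ (1 / 2 ^ i)` virtual processors. -/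
def segLabel (k j : ℕ) : ℕ := 2 ^ k - 2 ^ j

/-- Dummy messages from `VP_r` to `VP_{r + N / 2}`, for `0 ≤ r < N / 2`, where `N = 2 ^ 2 ^ j`. -/
def dummies (k j : ℕ) : Multiset (Message (2 ^ k) (2 ^ k)) :=
  (Finset.univ.filter fun r : VP k => (r : ℕ) < 2 ^ 2 ^ j / 2).val.map fun r =>
    ⟨r, Fin.ofNat (2 ^ 2 ^ k) ((r : ℕ) + 2 ^ 2 ^ j / 2), none⟩

/-- Each virtual processor `r` sends the value that it holds to `f r`. -/
def moves (k : ℕ) (W : VP k → VP k) (l : ℕ) (f : VP k → VP k) :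
    Multiset (Message (2 ^ k) (2 ^ k)) :=
  (Finset.univ : Finset (VP k)).val.map fun r => ⟨r, f r, some (node k (W r) l)⟩

/-- The two virtual processors of each segment of size two exchange their values. -/
def exchangeStep (k : ℕ) (W : VP k → VP k) (l : ℕ) : Superstep (2 ^ k) (2 ^ k) where
  label := segLabel k 0
  evals := 0
  msgs := moves k W l (partner k) + dummies k 0

/-- Each virtual processor evaluates the vertex of level `l + 1` on its wire. -/
def evalStep (k : ℕ) (W : VP k → VP k) (l : ℕ) : Superstep (2 ^ k) (2 ^ k) where
  label := segLabel k 0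
  evals := (Finset.univ : Finset (VP k)).val.map fun r => (r, node k (W r) (l + 1))
  msgs := dummies k 0

/-- The values held in each segment of size `2 ^ 2 ^ (j + 1)` are permuted by transposition. -/
def transposeStep (k j : ℕ) (W : VP k → VP k) (l : ℕ) : Superstep (2 ^ k) (2 ^ k) where
  label := segLabel k (j + 1)
  evals := 0
  msgs := moves k W l (transpose k j) + dummies k (j + 1)

/-- The wires held by the virtual processors after each segment of size `2 ^ 2 ^ j` has computed
its subDAG. -/
def wiresAfter (k : ℕ) : ℕ → (VP k → VP k) → (VP k → VP k)
  | 0, W => W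
  | j + 1, W => wiresAfter k j (wiresAfter k j W ∘ transpose k j)

/-- The supersteps in which each segment of size `2 ^ 2 ^ j` computes recursively the
`2 ^ 2 ^ j`-input subDAG whose inputs, at level `l`, are held by its virtual processors: first the
subDAGs of the first set, then the transposition, then the subDAGs of the second set. -/
def fftSteps (k : ℕ) : ℕ → (VP k → VP k) → ℕ → List (Superstep (2 ^ k) (2 ^ k))
  | 0, W, l => [exchangeStep k W l, evalStep k W l]
  | j + 1, W, l =>
    fftSteps k j W l ++
      [transposeStep k j (wiresAfter k j W) (l + 2 ^ j)] ++
      fftSteps k j (wiresAfter k j W ∘ transpose k j) (l + 2 ^ j)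

/-- The network-oblivious algorithm for `n = 2 ^ 2 ^ k` inputs, specified on `M(n)`; initially
`VP_r` holds the `r`-th input. -/
def fftAlgorithm (k : ℕ) : Algorithm (2 ^ k) (2 ^ k) where
  inputs := (Finset.univ : Finset (VP k)).val.map fun r => (r, r)
  steps := fftSteps k k id 0

end FFTNet

namespace FFTNet

/-! ### Counting in multisets -/

/-! Write `n = 2 ^ m` and `q = 2 ^ a`. The core is a lower bound on communication: for `2 ≤ q ≤ n`,
the sum `H` of all degrees of an admissible algorithm is at least a constant times `(n / q) * log n
/ log (2 n / q)` (`Placement.lower_bound`). The DAG has exactly one path from each input to each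
output, and each vertex lies on `n` of these `n ^ 2` paths. Hence a message serves at most `n`
paths, and progress along a path from one processing element to another needs a message that carries
a vertex of this path.

Two arguments complement each other. If few processing elements evaluate nearly all outputs
(`Placement.concentrated`), then either many paths end away from their start, or one processing
element stores most inputs; as the load bound leaves many vertices of some level to others, it must
then send a lot. If the outputs are scattered (`Placement.spread_bound`), put weight 1 where an
input is stored and let each message add the fraction `1 / σ` of the weight of its source to its
destination. The total weight grows to at most `exp (H / σ)`, whereas a path served by `c` messages
guarantees weight `σ ^ (-c)` at its end. On average `c` is at most `q H / n`, so a small `H` would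
yield more weight than there is. The choice `σ = n / q` gives the bound.

Applied to the foldings, this bounds the prefix sums `F^0 + ... + F^(j-1)` from below for every `j ≤
log p` (`InClass.lower_bound`). The FFT algorithm has only `O(log n / (log n - j + 1))` supersteps
with label less than `j` (`countP_label_fftSteps`), each of degree `O(n / p)` after folding, so its
prefix sums are of the order of the lower bound. For non-increasing `g`, domination of prefix sums
implies domination of the weighted sums (`sum_mul_le_of_partial_sums`), and `ℓ_i ≤ c * (n / p) *
g_i` allows the latency to be charged in the same way. Membership in the class rests on the fact
that the transpositions bring together exactly those wires that differ in the bit needed next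
(`Aligned.second`). -/

theorem sum_countP_fiber {α β : Type*} [Fintype β] [DecidableEq β] (f : α → β) (p : α → Prop)
    [DecidablePred p] (S : Multiset α) :
    ∑ b, S.countP (fun x => f x = b ∧ p x) = S.countP p := by
  induction S using Multiset.induction_on with
  | empty => simp
  | cons x S ih =>
    simp only [Multiset.countP_cons, Finset.sum_add_distrib, ih]
    congr 1
    by_cases hx : p x <;> simp [hx]

theorem countP_mono {α : Type*} {p q : α → Prop} [DecidablePred p] [DecidablePred q]
    (S : Multiset α) (h : ∀ x ∈ S, p x → q x) : S.countP p ≤ S.countP q := by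
  rw [Multiset.countP_eq_card_filter, Multiset.countP_eq_card_filter]
  refine Multiset.card_le_card ?_
  rw [Multiset.le_filter]
  refine ⟨Multiset.filter_le _ _, fun x hx => ?_⟩
  rw [Multiset.mem_filter] at hx
  exact h x hx.1 hx.2

theorem eq_of_countP_eq_one {α : Type*} {p : α → Prop} [DecidablePred p] {S : Multiset α}
    (h : S.countP p = 1) {x y : α} (hx : x ∈ S) (hy : y ∈ S) (px : p x) (py : p y) : x = y := by
  rw [Multiset.countP_eq_card_filter, Multiset.card_eq_one] at h
  obtain ⟨z, hz⟩ := h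
  have h1 : x ∈ S.filter p := Multiset.mem_filter.2 ⟨hx, px⟩
  have h2 : y ∈ S.filter p := Multiset.mem_filter.2 ⟨hy, py⟩
  rw [hz, Multiset.mem_singleton] at h1 h2
  rw [h1, h2]

theorem exists_of_countP_eq_one {α : Type*} {p : α → Prop} [DecidablePred p] {S : Multiset α}
    (h : S.countP p = 1) : ∃ x ∈ S, p x :=
  Multiset.countP_pos.1 (by omega)

/-! ### Paths of the FFT DAG

There is exactly one path from each input `w` to each output `w'`. -/

/-- The wire, at level `l`, of the path from the input `w` to the output `w'`. -/
def pathWire {m : ℕ} (l : ℕ) (w w' : Fin (2 ^ m)) : Fin (2 ^ m) :=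
  ⟨(w : ℕ) / 2 ^ l * 2 ^ l + (w' : ℕ) % 2 ^ l, by
    rcases le_total l m with h | h
    · have h1 : (w : ℕ) / 2 ^ l < 2 ^ (m - l) := Nat.div_lt_of_lt_mul (by
        rw [← pow_add, Nat.add_sub_cancel' h]; exact w.isLt)
      have h2 : (w' : ℕ) % 2 ^ l < 2 ^ l := Nat.mod_lt _ (by positivity)
      have h3 : 2 ^ m = 2 ^ (m - l) * 2 ^ l := by rw [← pow_add, Nat.sub_add_cancel h]
      calc (w : ℕ) / 2 ^ l * 2 ^ l + (w' : ℕ) % 2 ^ l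
          < ((w : ℕ) / 2 ^ l + 1) * 2 ^ l := by rw [add_mul, one_mul]; omega
        _ ≤ 2 ^ (m - l) * 2 ^ l := Nat.mul_le_mul_right _ h1
        _ = 2 ^ m := h3.symm
    · have h1 : (w : ℕ) < 2 ^ l := w.isLt.trans_le (Nat.pow_le_pow_right (by norm_num) h)
      rw [Nat.div_eq_of_lt h1, zero_mul, zero_add]
      exact (Nat.mod_le _ _).trans_lt w'.isLt⟩

theorem testBit_pathWire {m : ℕ} (l : ℕ) (w w' : Fin (2 ^ m)) (i : ℕ) :
    (pathWire l w w' : ℕ).testBit i =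
      if i < l then (w' : ℕ).testBit i else (w : ℕ).testBit i := by
  have h2 : (w' : ℕ) % 2 ^ l < 2 ^ l := Nat.mod_lt _ (by positivity)
  simp only [pathWire]
  rw [mul_comm, Nat.testBit_two_pow_mul_add _ h2]
  split_ifs with h
  · simp [h]
  · rw [Nat.testBit_div_two_pow, Nat.sub_add_cancel (by omega)]

theorem pathWire_zero {m : ℕ} (w w' : Fin (2 ^ m)) : pathWire 0 w w' = w := by
  ext; simp [pathWire, Nat.mod_one]

theorem pathWire_self {m : ℕ} (w w' : Fin (2 ^ m)) : pathWire m w w' = w' := by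
  ext; simp [pathWire, Nat.div_eq_of_lt w.isLt, Nat.mod_eq_of_lt w'.isLt]

/-- Exchanging the low `l` bits of two numbers is an involution. -/
theorem pathWire_pathWire {m : ℕ} (l : ℕ) (w w' : Fin (2 ^ m)) :
    pathWire l (pathWire l w w') (pathWire l w' w) = w := by
  apply Fin.ext
  apply Nat.eq_of_testBit_eq
  intro i
  simp only [testBit_pathWire]
  split_ifs <;> rfl

/-- Between levels `l` and `l + 1` only bit `l` changes, from that of the input to that of the
output; so consecutive vertices of a path are joined by an arc. -/
theorem pathWire_succ {m : ℕ} (l : ℕ) (w w' : Fin (2 ^ m)) :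
    pathWire l w w' = pathWire (l + 1) w w' ∨
      (pathWire l w w' : ℕ) ^^^ (pathWire (l + 1) w w' : ℕ) = 2 ^ l := by
  by_cases h : (w : ℕ).testBit l = (w' : ℕ).testBit l
  · left
    apply Fin.ext
    apply Nat.eq_of_testBit_eq
    intro i
    simp only [testBit_pathWire]
    split_ifs with h1 h2 h2
    · rfl
    · omega
    · have : i = l := by omega
      rw [this, h]
    · rfl
  · right
    apply Nat.eq_of_testBit_eq
    intro i
    rw [Nat.testBit_xor, testBit_pathWire, testBit_pathWire, Nat.testBit_two_pow]
    rcases lt_trichotomy i l with h1 | h1 | h1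
    · simp [h1, Nat.lt_succ_of_lt h1, (ne_of_lt h1).symm]
    · subst h1
      simp only [lt_irrefl, if_false, Nat.lt_succ_self, if_true, decide_true]
      revert h
      cases (w : ℕ).testBit i <;> cases (w' : ℕ).testBit i <;> simp
    · have h2 : ¬ i < l := by omega
      have h3 : ¬ i < l + 1 := by omega
      simp [h2, h3, ne_of_lt h1]

/-- Exchanging the low `l` bits of the endpoints. -/
def pathEquiv (m l : ℕ) : Fin (2 ^ m) × Fin (2 ^ m) ≃ Fin (2 ^ m) × Fin (2 ^ m) where
  toFun x := (pathWire l x.1 x.2, pathWire l x.2 x.1)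
  invFun x := (pathWire l x.1 x.2, pathWire l x.2 x.1)
  left_inv x := by simp [pathWire_pathWire]
  right_inv x := by simp [pathWire_pathWire]

/-- The path with endpoints `x.1` and `x.2` visits the vertex `v`. -/
def OnPath {m : ℕ} (x : Fin (2 ^ m) × Fin (2 ^ m)) (v : Node m) : Prop :=
  v.1 = pathWire (v.2 : ℕ) x.1 x.2

instance {m : ℕ} (x : Fin (2 ^ m) × Fin (2 ^ m)) (v : Node m) : Decidable (OnPath x v) :=
  inferInstanceAs (Decidable (_ = _))

/-- `pathEquiv` turns the wire at level `l` into a free coordinate, and the other coordinate is then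
arbitrary. -/
theorem card_pathWire_mem {m : ℕ} (l : ℕ) (p : Fin (2 ^ m) → Prop) [DecidablePred p] :
    (Finset.univ.filter fun x : Fin (2 ^ m) × Fin (2 ^ m) => p (pathWire l x.1 x.2)).card =
      (Finset.univ.filter p).card * 2 ^ m := by
  have h : (Finset.univ.filter fun x : Fin (2 ^ m) × Fin (2 ^ m) =>
      p (pathWire l x.1 x.2)).map (pathEquiv m l).toEmbedding =
      (Finset.univ.filter p) ×ˢ (Finset.univ : Finset (Fin (2 ^ m))) := by
    ext y
    simp only [Finset.mem_map_equiv, Finset.mem_filter, Finset.mem_univ, true_and,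
      Finset.mem_product, and_true]
    have : pathWire l ((pathEquiv m l).symm y).1 ((pathEquiv m l).symm y).2 = y.1 :=
      pathWire_pathWire l y.1 y.2
    rw [this]
  rw [← Finset.card_map (pathEquiv m l).toEmbedding, h, Finset.card_product]
  simp

theorem card_onPath {m : ℕ} (v : Node m) :
    (Finset.univ.filter fun x => OnPath x v).card = 2 ^ m := by
  have := card_pathWire_mem (m := m) (v.2 : ℕ) (fun w => v.1 = w)
  simp only [Finset.filter_eq, Finset.mem_univ, if_true, Finset.card_singleton, one_mul] at this
  exact this

/-- The message carries the value of a vertex of the path `x`. -/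
def Carries {m a : ℕ} (x : Fin (2 ^ m) × Fin (2 ^ m)) (μ : Message m a) : Prop :=
  ∃ v, μ.payload = some v ∧ OnPath x v

noncomputable instance {m a : ℕ} (x : Fin (2 ^ m) × Fin (2 ^ m)) (μ : Message m a) :
    Decidable (Carries x μ) := Classical.dec _

theorem card_carries_le {m a : ℕ} (μ : Message m a) :
    (Finset.univ.filter fun x => Carries x μ).card ≤ 2 ^ m := by
  rcases h : μ.payload with _ | v
  · simp [Carries, h]
  · refine (Finset.card_le_card (t := Finset.univ.filter fun x => OnPath x v)
      fun x hx => ?_).trans (card_onPath v).le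
    simp only [Finset.mem_filter, Finset.mem_univ, true_and, Carries, h, Option.some.injEq] at hx ⊢
    obtain ⟨u, rfl, hu⟩ := hx
    exact hu

/-- Each message serves at most `2 ^ m` of the `2 ^ m * 2 ^ m` paths. -/
theorem sum_countP_carries_le {m a : ℕ} (S : Multiset (Message m a)) (p : Message m a → Prop)
    [DecidablePred p] :
    ∑ x : Fin (2 ^ m) × Fin (2 ^ m), S.countP (fun μ => p μ ∧ Carries x μ) ≤
      2 ^ m * S.countP p := by
  induction S using Multiset.induction_on with
  | empty => simp
  | cons μ S ih =>
    simp only [Multiset.countP_cons, Finset.sum_add_distrib, mul_add]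
    refine add_le_add ih ?_
    by_cases hp : p μ
    · have := card_carries_le μ
      simpa [hp, Finset.sum_boole] using this
    · simp [hp]

/-! ### Tracing values along a path -/

/-- All messages of a list of supersteps. -/
def allMsgs {m a : ℕ} (L : List (Superstep m a)) : Multiset (Message m a) :=
  (L.map Superstep.msgs).sum

@[simp] theorem allMsgs_nil {m a : ℕ} : allMsgs ([] : List (Superstep m a)) = 0 := rfl

@[simp] theorem allMsgs_cons {m a : ℕ} (s : Superstep m a) (L : List (Superstep m a)) :
    allMsgs (s :: L) = s.msgs + allMsgs L := by simp [allMsgs]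

/-- The processing elements to which messages with values of the path `x` can have spread from
those in `X`. -/
def reach {m a : ℕ} (x : Fin (2 ^ m) × Fin (2 ^ m)) :
    Set (Fin (2 ^ a)) → List (Superstep m a) → Set (Fin (2 ^ a))
  | X, [] => X
  | X, s :: L => reach x (X ∪ {P | ∃ μ ∈ s.msgs, μ.dst = P ∧ μ.src ∈ X ∧ Carries x μ}) L

theorem subset_reach {m a : ℕ} (x : Fin (2 ^ m) × Fin (2 ^ m)) (L : List (Superstep m a)) :
    ∀ X, X ⊆ reach x X L := by
  induction L with
  | nil => intro X; exact subset_rfl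
  | cons s L ih => intro X; exact Set.subset_union_left.trans (ih _)

/-- An operand may be evaluated in the same superstep, in no prescribed order. Induction on the
level walks back along the path, staying at one processing element, until it meets a value already
in `M`; it must do so, because inputs are not evaluated. -/
theorem mem_of_afterEvals {m a : ℕ} {x : Fin (2 ^ m) × Fin (2 ^ m)} {s : Superstep m a}
    {M : Set (Fin (2 ^ a) × Node m)} {X : Set (Fin (2 ^ a))} (hs : s.Legal M)
    (h0 : ∀ e ∈ s.evals, e.2.2 ≠ 0) (hM : ∀ e ∈ M, OnPath x e.2 → e.1 ∈ X) :
    ∀ e ∈ s.afterEvals M, OnPath x e.2 → e.1 ∈ X := by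
  have key : ∀ l : ℕ, ∀ e ∈ s.afterEvals M, (e.2.2 : ℕ) = l → OnPath x e.2 → e.1 ∈ X := by
    intro l
    induction l with
    | zero =>
      rintro e (he | he) hl hx
      · exact hM e he hx
      · exact absurd (Fin.ext hl) (h0 e he)
    | succ l ih =>
      rintro ⟨P, w, j⟩ (he | he) hl hx
      · exact hM _ he hx
      · simp only at hl
        have hj := j.isLt
        refine ih (P, (pathWire l x.1 x.2, ⟨l, by omega⟩)) (hs.operands _ he _ ?_) rfl rfl
        refine ⟨hl, ?_⟩
        have hw : w = pathWire (l + 1) x.1 x.2 := by rw [← hl]; exact hx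
        simp only [hw]
        exact pathWire_succ l x.1 x.2
  intro e he hx
  exact key _ e he rfl hx

theorem mem_reach_of_mem_evals {m a : ℕ} {x : Fin (2 ^ m) × Fin (2 ^ m)}
    (L : List (Superstep m a)) :
    ∀ (M : Set (Fin (2 ^ a) × Node m)) (X : Set (Fin (2 ^ a))), LegalFrom M L →
      (∀ s ∈ L, ∀ e ∈ s.evals, e.2.2 ≠ 0) → (∀ e ∈ M, OnPath x e.2 → e.1 ∈ X) →
      ∀ s ∈ L, ∀ e ∈ s.evals, OnPath x e.2 → e.1 ∈ reach x X L := by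
  induction L with
  | nil => intro M X _ _ _ s hs; simp at hs
  | cons t L ih =>
    intro M X hL h0 hM s hs e he hx
    have hE := mem_of_afterEvals hL.1 (h0 t (by simp)) hM
    rcases List.mem_cons.1 hs with rfl | hs
    · exact subset_reach x _ X (hE e (Or.inr he) hx)
    · refine ih (t.afterSync M) _ hL.2 (fun s hs => h0 s (by simp [hs])) ?_ s hs e he hx
      rintro f (hf | ⟨μ, hμ, hd, hp⟩) hfx
      · exact Or.inl (hE f hf hfx)
      · exact Or.inr ⟨μ, hμ, hd, hE (μ.src, f.2) (hL.1.payloads μ hμ _ hp) hfx, f.2, hp, hfx⟩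

/-- The message by which `P` first enters the reachable set comes from inside that set, hence from
elsewhere. -/
theorem exists_received {m a : ℕ} {x : Fin (2 ^ m) × Fin (2 ^ m)} {P : Fin (2 ^ a)}
    (L : List (Superstep m a)) :
    ∀ X : Set (Fin (2 ^ a)), P ∈ reach x X L → P ∉ X →
      ∃ μ ∈ allMsgs L, (μ.dst = P ∧ μ.src ≠ P) ∧ Carries x μ := by
  induction L with
  | nil => intro X h h'; exact absurd h h'
  | cons s L ih =>
    intro X h h'
    by_cases hP : ∃ μ ∈ s.msgs, μ.dst = P ∧ μ.src ∈ X ∧ Carries x μ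
    · obtain ⟨μ, hμ, hd, hX, hc⟩ := hP
      refine ⟨μ, by simp [hμ], ⟨hd, fun h => h' (h ▸ hX)⟩, hc⟩
    · obtain ⟨μ, hμ, h1⟩ := ih _ h (by rintro (h | h); exacts [h' h, hP h])
      exact ⟨μ, by simp [hμ], h1⟩

theorem exists_sent {m a : ℕ} {x : Fin (2 ^ m) × Fin (2 ^ m)} {P Q : Fin (2 ^ a)}
    (hQ : Q ≠ P) (L : List (Superstep m a)) (h : Q ∈ reach x {P} L) :
    ∃ μ ∈ allMsgs L, (μ.src = P ∧ μ.dst ≠ P) ∧ Carries x μ := by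
  by_contra hc
  push Not at hc
  have key : ∀ L : List (Superstep m a),
      (∀ μ ∈ allMsgs L, μ.src = P ∧ μ.dst ≠ P → ¬ Carries x μ) → reach x {P} L = {P} := by
    intro L
    induction L with
    | nil => intro _; rfl
    | cons s L ih =>
      intro h
      have h2 : ({P} : Set (Fin (2 ^ a))) ∪
          {R | ∃ μ ∈ s.msgs, μ.dst = R ∧ μ.src ∈ ({P} : Set (Fin (2 ^ a))) ∧ Carries x μ} = {P} := by
        refine Set.union_eq_left.2 ?_
        rintro R ⟨μ, hμ, rfl, hs, hx⟩
        by_contra hne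
        exact h μ (by simp [hμ]) ⟨hs, hne⟩ hx
      rw [reach, h2]
      exact ih fun μ hμ => h μ (by simp [hμ])
  rw [key L hc] at h
  exact hQ h


/-! ### Degrees and numbers of messages -/

/-- Sum of the degrees of all supersteps. -/
def totalDegree {m a : ℕ} (L : List (Superstep m a)) : ℕ := (L.map Superstep.degree).sum

@[simp] theorem totalDegree_nil {m a : ℕ} : totalDegree ([] : List (Superstep m a)) = 0 := rfl

@[simp] theorem totalDegree_cons {m a : ℕ} (s : Superstep m a) (L : List (Superstep m a)) :
    totalDegree (s :: L) = s.degree + totalDegree L := by simp [totalDegree]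

theorem sent_le_degree {m a : ℕ} (s : Superstep m a) (P : Fin (2 ^ a)) : s.sent P ≤ s.degree :=
  (le_max_left _ _).trans
    (Finset.le_sup (f := fun P => max (s.sent P) (s.received P)) (Finset.mem_univ P))

theorem received_le_degree {m a : ℕ} (s : Superstep m a) (P : Fin (2 ^ a)) :
    s.received P ≤ s.degree :=
  (le_max_right _ _).trans
    (Finset.le_sup (f := fun P => max (s.sent P) (s.received P)) (Finset.mem_univ P))

theorem countP_sent_le {m a : ℕ} (L : List (Superstep m a)) (P : Fin (2 ^ a)) :
    (allMsgs L).countP (fun μ => μ.src = P ∧ μ.dst ≠ P) ≤ totalDegree L := by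
  induction L with
  | nil => simp
  | cons s L ih =>
    rw [allMsgs_cons, totalDegree_cons, Multiset.countP_add]
    exact add_le_add (sent_le_degree s P) ih

theorem countP_received_le {m a : ℕ} (L : List (Superstep m a)) (P : Fin (2 ^ a)) :
    (allMsgs L).countP (fun μ => μ.dst = P ∧ μ.src ≠ P) ≤ totalDegree L := by
  induction L with
  | nil => simp
  | cons s L ih =>
    rw [allMsgs_cons, totalDegree_cons, Multiset.countP_add]
    exact add_le_add (received_le_degree s P) ih

theorem countP_external_le {m a : ℕ} (L : List (Superstep m a)) :
    (allMsgs L).countP (fun μ => μ.dst ≠ μ.src) ≤ 2 ^ a * totalDegree L := by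
  rw [← sum_countP_fiber Message.src]
  calc _ ≤ ∑ _P : Fin (2 ^ a), totalDegree L := Finset.sum_le_sum fun P _ => by
        refine le_trans (countP_mono _ ?_) (countP_sent_le L P)
        rintro μ _ ⟨rfl, h⟩
        exact ⟨rfl, h⟩
    _ = _ := by simp

/-- If each path in `Ω` uses a message with the property `p`, there are few paths in `Ω`. -/
theorem card_paths_le {m a : ℕ} (S : Multiset (Message m a)) (p : Message m a → Prop)
    [DecidablePred p] (Ω : Finset (Fin (2 ^ m) × Fin (2 ^ m)))
    (h : ∀ x ∈ Ω, ∃ μ ∈ S, p μ ∧ Carries x μ) : Ω.card ≤ 2 ^ m * S.countP p := by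
  calc Ω.card = ∑ x ∈ Ω, 1 := by simp
    _ ≤ ∑ x ∈ Ω, S.countP (fun μ => p μ ∧ Carries x μ) := Finset.sum_le_sum fun x hx => by
        obtain ⟨μ, hμ, hp⟩ := h x hx
        exact Multiset.countP_pos_of_mem hμ hp
    _ ≤ ∑ x, S.countP (fun μ => p μ ∧ Carries x μ) :=
        Finset.sum_le_sum_of_subset (Finset.subset_univ _)
    _ ≤ _ := sum_countP_carries_le S p

/-! ### Placement of the vertices -/

/-- `own w` stores the `w`-th input and `ev v` evaluates the vertex `v`; only the information on
the communication and on the load is retained. -/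
structure Placement (ε : ℝ) {m a : ℕ} (L : List (Superstep m a)) (own : Fin (2 ^ m) → Fin (2 ^ a))
    (ev : Node m → Fin (2 ^ a)) : Prop where
  mem_reach : ∀ x v, v.2 ≠ 0 → OnPath x v → ev v ∈ reach x {own x.1} L
  load : ∀ P, ((Finset.univ.filter fun v : Node m => v.2 ≠ 0 ∧ ev v = P).card : ℝ) ≤
    ε * ((2 : ℝ) ^ m * (m : ℝ))

theorem Admissible.exists_placement {ε : ℝ} {m a : ℕ} {A : Algorithm m a} (h : Admissible ε A) :
    ∃ own ev, Placement ε A.steps own ev := by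
  have h1 : ∀ w, ∃ P, (P, w) ∈ A.inputs := fun w => by
    obtain ⟨⟨P, w'⟩, he, rfl⟩ := exists_of_countP_eq_one (h.input_once w)
    exact ⟨P, he⟩
  have h2 : ∀ v : Node m, ∃ P, v.2 ≠ 0 → (P, v) ∈ A.evals := fun v => by
    by_cases hv : v.2 = 0
    -- Inputs are not evaluated; the value of `ev` there is arbitrary and never used.
    · exact ⟨⟨0, by positivity⟩, fun h => absurd hv h⟩
    · obtain ⟨⟨P, v'⟩, he, rfl⟩ := exists_of_countP_eq_one (h.eval_once v hv)
      exact ⟨P, fun _ => he⟩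
  choose own hown using h1
  choose ev hev using h2
  have hmem : ∀ e, e ∈ A.evals ↔ ∃ s ∈ A.steps, e ∈ s.evals := fun e => by
    simp only [Algorithm.evals]
    generalize A.steps = L
    induction L with
    | nil => simp
    | cons s L ih => simp [ih]
  refine ⟨own, ev, ⟨fun x v hv hx => ?_, fun P => ?_⟩⟩
  · obtain ⟨s, hs, he⟩ := (hmem _).1 (hev v hv)
    refine mem_reach_of_mem_evals A.steps A.initialMemory {own x.1} h.legal
      (fun s hs e he => h.input_nodes e ((hmem e).2 ⟨s, hs, he⟩)) ?_ s hs _ he hx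
    rintro ⟨P, v⟩ ⟨w, hw, rfl⟩ hx
    simp only [OnPath, Fin.val_zero, pathWire_zero] at hx hw
    subst hx
    exact congrArg Prod.fst (eq_of_countP_eq_one (h.input_once x.1) hw (hown x.1) rfl rfl)
  · refine le_trans ?_ (h.load P)
    rw [Nat.cast_le, Multiset.countP_eq_card_filter]
    refine le_trans ?_ (Multiset.toFinset_card_le _)
    rw [← Finset.card_map ⟨fun v : Node m => (P, v), fun u v h => (Prod.ext_iff.1 h).2⟩]
    refine Finset.card_le_card ?_
    intro e he
    simp only [Finset.mem_map, Finset.mem_filter, Finset.mem_univ, true_and] at he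
    obtain ⟨v, ⟨hv, rfl⟩, rfl⟩ := he
    exact Multiset.mem_toFinset.2 (Multiset.mem_filter.2 ⟨hev v hv, rfl⟩)

/-! ### Communication when few processing elements evaluate the outputs -/

namespace Placement

variable {ε : ℝ} {m a : ℕ} {L : List (Superstep m a)} {own : Fin (2 ^ m) → Fin (2 ^ a)}
  {ev : Node m → Fin (2 ^ a)}

theorem out_mem_reach (h : Placement ε L own ev) (hm : 0 < m) (x : Fin (2 ^ m) × Fin (2 ^ m)) :
    ev (x.2, Fin.last m) ∈ reach x {own x.1} L := by
  refine h.mem_reach x _ (fun h => ?_) ?_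
  · have := congrArg Fin.val h
    simp at this
    omega
  · simp [OnPath, pathWire_self]

theorem card_received_le (h : Placement ε L own ev) (hm : 0 < m) (P : Fin (2 ^ a)) :
    (Finset.univ.filter fun x : Fin (2 ^ m) × Fin (2 ^ m) =>
      ev (x.2, Fin.last m) = P ∧ own x.1 ≠ P).card ≤ 2 ^ m * totalDegree L := by
  refine le_trans (card_paths_le (allMsgs L) (fun μ => μ.dst = P ∧ μ.src ≠ P) _ ?_)
    (Nat.mul_le_mul_left _ (countP_received_le L P))
  intro x hx
  simp only [Finset.mem_filter, Finset.mem_univ, true_and] at hx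
  refine exists_received L {own x.1} (hx.1 ▸ h.out_mem_reach hm x) ?_
  simpa using hx.2.symm

theorem card_sent_le (h : Placement ε L own ev) (P : Fin (2 ^ a)) (l : Fin (m + 1)) (hl : l ≠ 0) :
    (Finset.univ.filter fun x : Fin (2 ^ m) × Fin (2 ^ m) =>
      own x.1 = P ∧ ev (pathWire l x.1 x.2, l) ≠ P).card ≤ 2 ^ m * totalDegree L := by
  refine le_trans (card_paths_le (allMsgs L) (fun μ => μ.src = P ∧ μ.dst ≠ P) _ ?_)
    (Nat.mul_le_mul_left _ (countP_sent_le L P))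
  intro x hx
  simp only [Finset.mem_filter, Finset.mem_univ, true_and] at hx
  refine exists_sent hx.2 L ?_
  have := h.mem_reach x (pathWire l x.1 x.2, l) hl rfl
  rwa [hx.1] at this

/-- On some level, the vertices that `P` does not evaluate have at least their average density. -/
theorem exists_level (h : Placement ε L own ev) (hm : 0 < m) (P : Fin (2 ^ a)) :
    ∃ l : Fin (m + 1), l ≠ 0 ∧ (1 - ε) * (2 : ℝ) ^ m ≤
      ((Finset.univ.filter fun w : Fin (2 ^ m) => ev (w, l) ≠ P).card : ℝ) := by
  by_contra hc
  push Not at hc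
  have h1 : (Finset.univ.filter fun v : Node m => v.2 ≠ 0 ∧ ev v = P).card =
      ∑ l : Fin (m + 1), (Finset.univ.filter fun w : Fin (2 ^ m) => l ≠ 0 ∧ ev (w, l) = P).card := by
    simp only [Finset.card_filter]
    rw [Fintype.sum_prod_type, Finset.sum_comm]
  have h2 := h.load P
  rw [h1, Fin.sum_univ_succ] at h2
  simp only [ne_eq, not_true_eq_false, false_and, Finset.filter_false, Finset.card_empty, zero_add,
    Fin.succ_ne_zero, not_false_eq_true, true_and] at h2
  push_cast at h2
  have h3 : ∀ l : Fin m, ε * (2 : ℝ) ^ m <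
      ((Finset.univ.filter fun w : Fin (2 ^ m) => ev (w, l.succ) = P).card : ℝ) := by
    intro l
    have h4 := hc l.succ (Fin.succ_ne_zero l)
    have h5 := Finset.card_filter_add_card_filter_not (s := (Finset.univ : Finset (Fin (2 ^ m))))
      (fun w => ev (w, l.succ) = P)
    rw [Finset.card_univ, Fintype.card_fin] at h5
    have h6 : ((Finset.univ.filter fun w : Fin (2 ^ m) => ev (w, l.succ) = P).card : ℝ) +
      ((Finset.univ.filter fun w : Fin (2 ^ m) => ¬ ev (w, l.succ) = P).card : ℝ) = (2 : ℝ) ^ m := by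
      exact_mod_cast h5
    simp only [ne_eq] at h4
    linarith
  have h7 : ∑ _l : Fin m, ε * (2 : ℝ) ^ m <
      ∑ l : Fin m, ((Finset.univ.filter fun w : Fin (2 ^ m) => ev (w, l.succ) = P).card : ℝ) :=
    Finset.sum_lt_sum_of_nonempty ⟨⟨0, hm⟩, Finset.mem_univ _⟩ fun l _ => h3 l
  simp only [Finset.sum_const, Finset.card_univ, Fintype.card_fin, nsmul_eq_mul] at h7
  nlinarith

/-- If the processing elements of a small set `B` evaluate nearly all outputs, there is a lot of
communication. -/
theorem concentrated (h : Placement ε L own ev) (hm : 0 < m) {θ : ℝ} (hθ : θ = (1 - ε) / 4)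
    (B : Finset (Fin (2 ^ a)))
    (hB : ((Finset.univ.filter fun w : Fin (2 ^ m) => ev (w, Fin.last m) ∉ B).card : ℝ) ≤
      θ * (2 : ℝ) ^ m) :
    2 * θ * (2 : ℝ) ^ m ≤ totalDegree L ∨ θ * (2 : ℝ) ^ m < (B.card : ℝ) * totalDegree L := by
  by_contra hc
  push Not at hc
  obtain ⟨hc1, hc2⟩ := hc
  have hn : (0 : ℝ) < (2 : ℝ) ^ m := by positivity
  set out : Fin (2 ^ m) → Fin (2 ^ a) := fun w => ev (w, Fin.last m) with hout
  -- few paths end at a processing element other than the one where they start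
  have h1 : ((Finset.univ.filter fun x : Fin (2 ^ m) × Fin (2 ^ m) => own x.1 ≠ out x.2).card : ℝ)
      ≤ 2 * θ * (2 : ℝ) ^ m * (2 : ℝ) ^ m := by
    have h2 : (Finset.univ.filter fun x : Fin (2 ^ m) × Fin (2 ^ m) => own x.1 ≠ out x.2) ⊆
        (Finset.univ ×ˢ Finset.univ.filter fun w : Fin (2 ^ m) => out w ∉ B) ∪
        B.biUnion fun P => Finset.univ.filter fun x : Fin (2 ^ m) × Fin (2 ^ m) =>
          out x.2 = P ∧ own x.1 ≠ P := by
      intro x hx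
      simp only [Finset.mem_filter, Finset.mem_univ, true_and, Finset.mem_union,
        Finset.mem_product, Finset.mem_biUnion] at hx ⊢
      by_cases hxB : out x.2 ∈ B
      · exact Or.inr ⟨_, hxB, rfl, hx⟩
      · exact Or.inl hxB
    have h3 := (Finset.card_le_card h2).trans (Finset.card_union_le _ _)
    have h4 := Finset.card_biUnion_le_card_mul B (fun P => Finset.univ.filter
      fun x : Fin (2 ^ m) × Fin (2 ^ m) => out x.2 = P ∧ own x.1 ≠ P) _
      (fun P _ => h.card_received_le hm P)
    rw [Finset.card_product, Finset.card_univ, Fintype.card_fin] at h3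
    have h5 : ((Finset.univ.filter fun x : Fin (2 ^ m) × Fin (2 ^ m) =>
        own x.1 ≠ out x.2).card : ℝ) ≤
        (2 : ℝ) ^ m * ((Finset.univ.filter fun w : Fin (2 ^ m) => out w ∉ B).card : ℝ) +
        (B.card : ℝ) * ((2 : ℝ) ^ m * totalDegree L) := by
      exact_mod_cast h3.trans (Nat.add_le_add_left h4 _)
    have h6 : (2 : ℝ) ^ m * ((Finset.univ.filter fun w : Fin (2 ^ m) => out w ∉ B).card : ℝ) ≤
      (2 : ℝ) ^ m * (θ * (2 : ℝ) ^ m) := mul_le_mul_of_nonneg_left hB hn.le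
    nlinarith
  -- hence some processing element stores nearly all inputs
  obtain ⟨P, hP⟩ : ∃ P, ((Finset.univ.filter fun w : Fin (2 ^ m) => own w ≠ P).card : ℝ) ≤
      2 * θ * (2 : ℝ) ^ m := by
    by_contra hc
    push Not at hc
    -- Averaging over the outputs `w'`: the processing element sought can be taken to be some `out
    -- w'`.
    have h2 : (Finset.univ.filter fun x : Fin (2 ^ m) × Fin (2 ^ m) => own x.1 ≠ out x.2).card =
        ∑ w', (Finset.univ.filter fun w : Fin (2 ^ m) => own w ≠ out w').card := by
      simp only [Finset.card_filter]
      rw [Fintype.sum_prod_type, Finset.sum_comm]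
    rw [h2] at h1
    push_cast at h1
    have h3 : ∑ _w' : Fin (2 ^ m), 2 * θ * (2 : ℝ) ^ m <
        ∑ w', ((Finset.univ.filter fun w : Fin (2 ^ m) => own w ≠ out w').card : ℝ) :=
      Finset.sum_lt_sum_of_nonempty ⟨⟨0, by positivity⟩, Finset.mem_univ _⟩ fun w' _ => hc _
    simp only [Finset.sum_const, Finset.card_univ, Fintype.card_fin, nsmul_eq_mul] at h3
    push_cast at h3
    linarith
  -- At least `4 θ n` vertices of level `l` are evaluated outside `P`, with `n` paths through each.
  -- At most `2 θ n ^ 2` paths start outside `P`, so at least `2 θ n ^ 2` paths leave `P`, and each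
  -- message serves at most `n` of them.
  obtain ⟨l, hl, hl2⟩ := h.exists_level hm P
  have h2 : (Finset.univ.filter fun x : Fin (2 ^ m) × Fin (2 ^ m) =>
      ev (pathWire l x.1 x.2, l) ≠ P) ⊆
      ((Finset.univ.filter fun w : Fin (2 ^ m) => own w ≠ P) ×ˢ Finset.univ) ∪
      Finset.univ.filter fun x : Fin (2 ^ m) × Fin (2 ^ m) =>
        own x.1 = P ∧ ev (pathWire l x.1 x.2, l) ≠ P := by
    intro x hx
    simp only [Finset.mem_filter, Finset.mem_univ, true_and, Finset.mem_union,
      Finset.mem_product, and_true] at hx ⊢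
    by_cases hxP : own x.1 = P
    · exact Or.inr ⟨hxP, hx⟩
    · exact Or.inl hxP
  have h3 := (Finset.card_le_card h2).trans (Finset.card_union_le _ _)
  rw [card_pathWire_mem (l : ℕ) (fun w => ev (w, l) ≠ P), Finset.card_product, Finset.card_univ,
    Fintype.card_fin] at h3
  have h4 := h3.trans (Nat.add_le_add_left (h.card_sent_le P l hl) _)
  have h5 : ((Finset.univ.filter fun w : Fin (2 ^ m) => ev (w, l) ≠ P).card : ℝ) * (2 : ℝ) ^ m ≤
      ((Finset.univ.filter fun w : Fin (2 ^ m) => own w ≠ P).card : ℝ) * (2 : ℝ) ^ m +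
      (2 : ℝ) ^ m * totalDegree L := by exact_mod_cast h4
  have h6 : ((Finset.univ.filter fun w : Fin (2 ^ m) => ev (w, l) ≠ P).card : ℝ) ≤
      ((Finset.univ.filter fun w : Fin (2 ^ m) => own w ≠ P).card : ℝ) + totalDegree L := by
    refine le_of_mul_le_mul_right ?_ hn
    linarith
  have h7 : (1 - ε) * (2 : ℝ) ^ m = 4 * θ * (2 : ℝ) ^ m := by rw [hθ]; ring
  linarith

end Placement


/-! ### Counting the ways in which values can spread -/

/-- Weights of the processing elements after the supersteps of a list: each message adds the
weight of its source, divided by `σ`, to the weight of its destination. -/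
noncomputable def spread {m a : ℕ} (σ : ℝ) :
    (Fin (2 ^ a) → ℝ) → List (Superstep m a) → (Fin (2 ^ a) → ℝ)
  | f, [] => f
  | f, s :: L => spread σ (fun P => f P + (∑ Q, (s.msgs.countP
      (fun μ => μ.dst = P ∧ (μ.src = Q ∧ μ.dst ≠ Q)) : ℝ) * f Q) / σ) L

theorem spread_nonneg {m a : ℕ} {σ : ℝ} (hσ : 0 < σ) (L : List (Superstep m a)) :
    ∀ f : Fin (2 ^ a) → ℝ, (∀ P, 0 ≤ f P) → ∀ P, 0 ≤ spread σ f L P := by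
  induction L with
  | nil => intro f hf; exact hf
  | cons s L ih =>
    intro f hf
    refine ih _ fun P => ?_
    have := Finset.sum_nonneg (s := Finset.univ) fun Q _ => mul_nonneg (Nat.cast_nonneg (α := ℝ)
      (s.msgs.countP (fun μ => μ.dst = P ∧ (μ.src = Q ∧ μ.dst ≠ Q)))) (hf Q)
    have := hf P
    positivity

/-- A processing element sends at most `degree` messages in a superstep, so the total weight is
multiplied by at most `1 + degree / σ ≤ exp (degree / σ)`. -/
theorem sum_spread_le {m a : ℕ} {σ : ℝ} (hσ : 0 < σ) (L : List (Superstep m a)) :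
    ∀ f : Fin (2 ^ a) → ℝ, (∀ P, 0 ≤ f P) →
      ∑ P, spread σ f L P ≤ Real.exp (totalDegree L / σ) * ∑ P, f P := by
  induction L with
  | nil => intro f hf; simp [spread]
  | cons s L ih =>
    intro f hf
    have hg : ∀ P, 0 ≤ f P + (∑ Q, (s.msgs.countP
        (fun μ => μ.dst = P ∧ (μ.src = Q ∧ μ.dst ≠ Q)) : ℝ) * f Q) / σ := fun P =>
      add_nonneg (hf P) (div_nonneg (Finset.sum_nonneg fun Q _ =>
        mul_nonneg (Nat.cast_nonneg _) (hf Q)) hσ.le)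
    have h1 : ∑ P, (f P + (∑ Q, (s.msgs.countP
        (fun μ => μ.dst = P ∧ (μ.src = Q ∧ μ.dst ≠ Q)) : ℝ) * f Q) / σ) ≤
        (1 + s.degree / σ) * ∑ P, f P := by
      rw [Finset.sum_add_distrib, ← Finset.sum_div, Finset.sum_comm, add_mul, one_mul]
      refine add_le_add le_rfl ?_
      rw [div_mul_eq_mul_div]
      refine div_le_div_of_nonneg_right ?_ hσ.le
      rw [Finset.mul_sum]
      refine Finset.sum_le_sum fun Q _ => ?_
      rw [← Finset.sum_mul]
      refine mul_le_mul_of_nonneg_right ?_ (hf Q)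
      rw [← Nat.cast_sum, sum_countP_fiber Message.dst, Nat.cast_le]
      exact sent_le_degree s Q
    have h0 : 0 ≤ ∑ P, f P := Finset.sum_nonneg fun P _ => hf P
    calc _ ≤ Real.exp (totalDegree L / σ) * _ := ih _ hg
      _ ≤ Real.exp (totalDegree L / σ) * ((1 + s.degree / σ) * ∑ P, f P) :=
        mul_le_mul_of_nonneg_left h1 (Real.exp_pos _).le
      _ ≤ Real.exp (totalDegree L / σ) * (Real.exp (s.degree / σ) * ∑ P, f P) := by
        refine mul_le_mul_of_nonneg_left (mul_le_mul_of_nonneg_right ?_ h0) (Real.exp_pos _).le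
        rw [add_comm]
        exact Real.add_one_le_exp _
      _ = _ := by
        rw [← mul_assoc, ← Real.exp_add, totalDegree_cons, Nat.cast_add, add_div, add_comm]

/-- A value that has arrived somewhere accounts for weight there, depending on the number of
messages with values of its path. -/
theorem le_spread {m a : ℕ} {x : Fin (2 ^ m) × Fin (2 ^ m)} {σ : ℝ} (hσ : 1 ≤ σ)
    (L : List (Superstep m a)) :
    ∀ (f : Fin (2 ^ a) → ℝ) (X : Set (Fin (2 ^ a))) (y : ℝ), 0 ≤ y → (∀ P, 0 ≤ f P) →
      (∀ P ∈ X, y ≤ f P) → ∀ P ∈ reach x X L,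
        y * σ⁻¹ ^ (allMsgs L).countP (fun μ => μ.dst ≠ μ.src ∧ Carries x μ) ≤ spread σ f L P := by
  have hσ0 : 0 < σ := by linarith
  have hσ1 : σ⁻¹ ≤ 1 := inv_le_one_of_one_le₀ hσ
  have hσ2 : 0 ≤ σ⁻¹ := inv_nonneg.2 hσ0.le
  induction L with
  | nil => intro f X y hy hf hX P hP; simpa [spread] using hX P hP
  | cons s L ih =>
    intro f X y hy hf hX P hP
    have hnn : ∀ P, 0 ≤ ∑ Q, (s.msgs.countP
        (fun μ => μ.dst = P ∧ (μ.src = Q ∧ μ.dst ≠ Q)) : ℝ) * f Q := fun P =>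
      Finset.sum_nonneg fun Q _ => mul_nonneg (Nat.cast_nonneg _) (hf Q)
    set c := s.msgs.countP (fun μ => μ.dst ≠ μ.src ∧ Carries x μ) with hc
    have hyc : y * σ⁻¹ ^ c ≤ y := mul_le_of_le_one_right hy (pow_le_one₀ hσ2 hσ1)
    rw [allMsgs_cons, Multiset.countP_add, pow_add, ← mul_assoc]
    refine ih _ _ (y * σ⁻¹ ^ c) (mul_nonneg hy (pow_nonneg hσ2 _))
      (fun P => add_nonneg (hf P) (div_nonneg (hnn P) hσ0.le)) ?_ P hP
    have hold : ∀ R ∈ X, y * σ⁻¹ ^ c ≤ f R + (∑ Q, (s.msgs.countP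
        (fun μ => μ.dst = R ∧ (μ.src = Q ∧ μ.dst ≠ Q)) : ℝ) * f Q) / σ := fun R hR => by
      have := hX R hR
      have := div_nonneg (hnn R) hσ0.le
      linarith
    rintro R (hR | ⟨μ, hμ, rfl, hsX, hx⟩)
    · exact hold R hR
    by_cases hne : μ.dst = μ.src
    · exact hold _ (hne ▸ hsX)
    have hc1 : c ≠ 0 := by
      have : 0 < c := Multiset.countP_pos_of_mem hμ ⟨hne, hx⟩
      omega
    -- Within one superstep a value makes a single hop, which costs one factor `σ⁻¹`; charging for
    -- all `c ≥ 1` messages of the path only weakens the bound.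
    have h1 : y * σ⁻¹ ^ c ≤ y * σ⁻¹ :=
      mul_le_mul_of_nonneg_left (pow_le_of_le_one hσ2 hσ1 hc1) hy
    have h2 : (1 : ℝ) ≤ (s.msgs.countP
        (fun ν => ν.dst = μ.dst ∧ (ν.src = μ.src ∧ ν.dst ≠ μ.src)) : ℝ) := by
      have : 0 < s.msgs.countP (fun ν => ν.dst = μ.dst ∧ (ν.src = μ.src ∧ ν.dst ≠ μ.src)) :=
        Multiset.countP_pos_of_mem hμ ⟨rfl, rfl, hne⟩
      exact_mod_cast this
    have h3 := Finset.single_le_sum (f := fun Q => (s.msgs.countP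
        (fun ν => ν.dst = μ.dst ∧ (ν.src = Q ∧ ν.dst ≠ Q)) : ℝ) * f Q)
        (fun Q _ => mul_nonneg (Nat.cast_nonneg _) (hf Q)) (Finset.mem_univ μ.src)
    have h4 : y ≤ ∑ Q, (s.msgs.countP
        (fun ν => ν.dst = μ.dst ∧ (ν.src = Q ∧ ν.dst ≠ Q)) : ℝ) * f Q := by
      refine le_trans ?_ h3
      have := hX _ hsX
      have := hf μ.src
      nlinarith
    have h5 : y * σ⁻¹ ≤ (∑ Q, (s.msgs.countP
        (fun ν => ν.dst = μ.dst ∧ (ν.src = Q ∧ ν.dst ≠ Q)) : ℝ) * f Q) / σ := by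
      rw [div_eq_mul_inv]
      exact mul_le_mul_of_nonneg_right h4 hσ2
    have := hf μ.dst
    linarith

/-- A case of Jensen's inequality. -/
theorem card_mul_exp_neg_le {ι : Type*} (s : Finset ι) (f : ι → ℝ) (t : ℝ)
    (h : ∑ i ∈ s, f i ≤ s.card * t) : s.card * Real.exp (-t) ≤ ∑ i ∈ s, Real.exp (-f i) := by
  -- The graph of `exp` lies above its tangent at `-t`; the linear terms are controlled by the
  -- hypothesis on the sum.
  have h1 : ∀ i ∈ s, Real.exp (-t) * (1 + t - f i) ≤ Real.exp (-f i) := fun i _ => by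
    have := Real.add_one_le_exp (t - f i)
    calc _ ≤ Real.exp (-t) * Real.exp (t - f i) :=
          mul_le_mul_of_nonneg_left (by linarith) (Real.exp_pos _).le
      _ = _ := by rw [← Real.exp_add]; congr 1; ring
  refine le_trans ?_ (Finset.sum_le_sum h1)
  rw [← Finset.mul_sum, Finset.sum_sub_distrib, Finset.sum_const, nsmul_eq_mul, mul_comm]
  exact mul_le_mul_of_nonneg_left (by linarith) (Real.exp_pos _).le

namespace Placement

variable {ε : ℝ} {m a : ℕ} {L : List (Superstep m a)} {own : Fin (2 ^ m) → Fin (2 ^ a)}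
  {ev : Node m → Fin (2 ^ a)}

/-- If many outputs are evaluated by processing elements that evaluate at most `T` outputs, their
values depend on inputs from many places. -/
theorem spread_bound (h : Placement ε L own ev) (hm : 0 < m) {θ T σ : ℝ} (hθ : 0 < θ)
    (hσ : 1 ≤ σ) (G : Finset (Fin (2 ^ m))) (hG : θ * (2 : ℝ) ^ m ≤ G.card)
    (hT : ∀ P, ((G.filter fun w => ev (w, Fin.last m) = P).card : ℝ) ≤ T) :
    θ * (2 : ℝ) ^ m *
      Real.exp (-(Real.log σ * ((2 : ℝ) ^ a * totalDegree L) / (θ * (2 : ℝ) ^ m))) ≤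
      T * Real.exp (totalDegree L / σ) := by
  have hσ0 : 0 < σ := by linarith
  have hn : (0 : ℝ) < (2 : ℝ) ^ m := by positivity
  have hlog := Real.log_nonneg hσ
  set H := (totalDegree L : ℝ) with hH
  have hH0 : 0 ≤ H := Nat.cast_nonneg _
  set c : Fin (2 ^ m) × Fin (2 ^ m) → ℕ := fun x =>
    (allMsgs L).countP (fun μ => μ.dst ≠ μ.src ∧ Carries x μ) with hc
  set Ω : Finset (Fin (2 ^ m) × Fin (2 ^ m)) := Finset.univ ×ˢ G with hΩ
  have hΩc : (Ω.card : ℝ) = (2 : ℝ) ^ m * G.card := by simp [hΩ]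
  -- There are at most `q H` messages between different processing elements, and each serves at most
  -- `n` paths.
  have h1 : ∑ x ∈ Ω, (c x : ℝ) ≤ (2 : ℝ) ^ m * ((2 : ℝ) ^ a * H) := by
    have h2 : ∑ x ∈ Ω, c x ≤ 2 ^ m * (2 ^ a * totalDegree L) :=
      (Finset.sum_le_sum_of_subset (Finset.subset_univ _)).trans
        ((sum_countP_carries_le (allMsgs L) fun μ => μ.dst ≠ μ.src).trans
          (Nat.mul_le_mul_left _ (countP_external_le L)))
    rw [hH]
    exact_mod_cast h2
  set t := Real.log σ * ((2 : ℝ) ^ a * H) / (θ * (2 : ℝ) ^ m) with ht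
  have ht0 : 0 ≤ t := by positivity
  have h2 : ∑ x ∈ Ω, Real.log σ * c x ≤ Ω.card * t := by
    rw [← Finset.mul_sum]
    calc _ ≤ Real.log σ * ((2 : ℝ) ^ m * ((2 : ℝ) ^ a * H)) := mul_le_mul_of_nonneg_left h1 hlog
      _ = ((2 : ℝ) ^ m * (θ * (2 : ℝ) ^ m)) * t := by rw [ht]; field_simp
      _ ≤ Ω.card * t := by
        rw [hΩc]
        exact mul_le_mul_of_nonneg_right (mul_le_mul_of_nonneg_left hG hn.le) ht0
  have h3 := card_mul_exp_neg_le Ω (fun x => Real.log σ * c x) t h2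
  -- The initial weight: one unit at the processing element that stores the input.
  set δ : Fin (2 ^ a) → Fin (2 ^ a) → ℝ := fun P Q => if Q = P then 1 else 0 with hδ
  have hδ0 : ∀ P Q, 0 ≤ δ P Q := fun P Q => by simp only [hδ]; split_ifs <;> norm_num
  have h4 : ∀ x ∈ Ω, Real.exp (-(Real.log σ * c x)) ≤
      spread σ (δ (own x.1)) L (ev (x.2, Fin.last m)) := fun x _ => by
    have h5 := le_spread (x := x) hσ L (δ (own x.1)) {own x.1} 1 zero_le_one (hδ0 _)
      (by rintro P rfl; simp [hδ]) _ (h.out_mem_reach hm x)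
    refine le_trans (le_of_eq ?_) h5
    rw [one_mul, inv_pow, Real.exp_neg, mul_comm, Real.exp_nat_mul, Real.exp_log hσ0]
  have h5 : ∀ w, ∑ w' ∈ G, spread σ (δ (own w)) L (ev (w', Fin.last m)) ≤
      T * Real.exp (H / σ) := fun w => by
    have h6 : ∀ w' ∈ G, spread σ (δ (own w)) L (ev (w', Fin.last m)) =
        ∑ P, if ev (w', Fin.last m) = P then spread σ (δ (own w)) L P else 0 := fun w' _ => by
      simp
    rw [Finset.sum_congr rfl h6, Finset.sum_comm]
    have hT0 : 0 ≤ T := le_trans (Nat.cast_nonneg _) (hT (own w))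
    calc _ ≤ ∑ P, T * spread σ (δ (own w)) L P := Finset.sum_le_sum fun P _ => by
          rw [← Finset.sum_filter, Finset.sum_const, nsmul_eq_mul]
          exact mul_le_mul_of_nonneg_right (hT P) (spread_nonneg hσ0 L _ (hδ0 _) P)
      _ ≤ T * (Real.exp (H / σ) * ∑ P, δ (own w) P) := by
          rw [← Finset.mul_sum]
          exact mul_le_mul_of_nonneg_left (sum_spread_le hσ0 L _ (hδ0 _)) hT0
      _ = _ := by simp [hδ]
  have h6 : ∑ x ∈ Ω, Real.exp (-(Real.log σ * c x)) ≤ (2 : ℝ) ^ m * (T * Real.exp (H / σ)) := by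
    refine (Finset.sum_le_sum h4).trans ?_
    rw [hΩ, Finset.sum_product]
    refine (Finset.sum_le_sum fun w _ => h5 w).trans (le_of_eq ?_)
    simp
  have h7 : (2 : ℝ) ^ m * (G.card * Real.exp (-t)) ≤ (2 : ℝ) ^ m * (T * Real.exp (H / σ)) := by
    rw [← mul_assoc, ← hΩc]
    exact h3.trans h6
  have h8 := le_of_mul_le_mul_left h7 hn
  exact (mul_le_mul_of_nonneg_right hG (Real.exp_pos _).le).trans h8

end Placement

/-! ### The lower bound on the total degree -/

/-- The constant in the lower bound on the communication, with `θ = (1 - ε) / 4`. -/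
noncomputable def lowerConst (ε : ℝ) : ℝ :=
  (1 - ε) / 4 / (8 * (Real.log (1 / ((1 - ε) / 4)) + 1))

theorem lowerConst_pos {ε : ℝ} (hε : 1 / 2 ≤ ε) (hε' : ε < 1) : 0 < lowerConst ε := by
  have h1 : 0 < (1 - ε) / 4 := by linarith
  have h2 : 0 ≤ Real.log (1 / ((1 - ε) / 4)) := Real.log_nonneg (by
    rw [le_div_iff₀ h1]; linarith)
  unfold lowerConst
  positivity

theorem le_two_rpow_quarter (m : ℕ) : (m : ℝ) / 8 ≤ (2 : ℝ) ^ ((m : ℝ) / 4) := by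
  rw [Real.rpow_def_of_pos (by norm_num)]
  have h1 := Real.add_one_le_exp (Real.log 2 * ((m : ℝ) / 4))
  have h2 := Real.log_two_gt_d9
  have h3 : (0 : ℝ) ≤ m := Nat.cast_nonneg m
  nlinarith

theorem Placement.lower_bound {ε : ℝ} (hε : 1 / 2 ≤ ε) (hε' : ε < 1) {m a : ℕ}
    {L : List (Superstep m a)} {own : Fin (2 ^ m) → Fin (2 ^ a)} {ev : Node m → Fin (2 ^ a)}
    (h : Placement ε L own ev) (ha : 1 ≤ a) (ham : a ≤ m) :
    lowerConst ε * ((2 : ℝ) ^ (m - a) * m) ≤ totalDegree L * ((m - a : ℕ) + 1 : ℝ) := by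
  have hm : 0 < m := by omega
  set θ := (1 - ε) / 4 with hθ
  have hθ0 : 0 < θ := by rw [hθ]; linarith
  have hθ1 : θ ≤ 1 / 8 := by rw [hθ]; linarith
  set Λ := Real.log (1 / θ) with hΛ
  have hΛ0 : 0 ≤ Λ := Real.log_nonneg (by rw [le_div_iff₀ hθ0]; linarith)
  have hlc : lowerConst ε = θ / (8 * (Λ + 1)) := rfl
  have hlc1 : lowerConst ε ≤ θ / 8 := by
    rw [hlc]
    exact div_le_div_of_nonneg_left hθ0.le (by norm_num) (by linarith)
  set H := (totalDegree L : ℝ) with hH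
  set s := (2 : ℝ) ^ (m - a) with hs
  set d := ((m - a : ℕ) : ℝ) with hd
  have hd0 : 0 ≤ d := Nat.cast_nonneg _
  have hda : d = (m : ℝ) - a := by rw [hd, Nat.cast_sub ham]
  have hs0 : 0 < s := by positivity
  have hs1 : 1 ≤ s := one_le_pow₀ (by norm_num)
  have hn : (0 : ℝ) < (2 : ℝ) ^ m := by positivity
  have hq : (0 : ℝ) < (2 : ℝ) ^ a := by positivity
  have hsq : (2 : ℝ) ^ m = s * (2 : ℝ) ^ a := by rw [hs, ← pow_add, Nat.sub_add_cancel ham]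
  have hm0 : (0 : ℝ) < m := by exact_mod_cast hm
  have hH0 : 0 ≤ H := Nat.cast_nonneg _
  have hq1 : (1 : ℝ) ≤ (2 : ℝ) ^ a := one_le_pow₀ (by norm_num)
  -- the communication is at least proportional to `n / q`
  have hHs : θ * s ≤ H := by
    rcases h.concentrated hm hθ Finset.univ (by simp; positivity) with h1 | h1
    · rw [hsq] at h1
      have : θ * s ≤ θ * s * (2 : ℝ) ^ a := le_mul_of_one_le_right (by positivity) hq1
      have : 0 < θ * s := by positivity
      linarith
    · rw [hsq, Finset.card_univ, Fintype.card_fin] at h1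
      push_cast at h1
      have h2 : (2 : ℝ) ^ a * (θ * s) ≤ (2 : ℝ) ^ a * H := by linarith
      exact le_of_mul_le_mul_left h2 hq
  have hsm : 0 ≤ s * m := by positivity
  -- For `q ≤ √n` the quotient `log n / log (2 n / q)` is bounded, and the bound `θ n / q` suffices.
  rcases le_or_gt (2 * a) m with h2a | h2a
  · have h1 : (2 * a : ℝ) ≤ m := by exact_mod_cast h2a
    calc _ ≤ θ / 8 * (s * m) := mul_le_mul_of_nonneg_right hlc1 hsm
      _ ≤ θ * s * (d + 1) := by
        have : 0 < θ * s := by positivity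
        have : (m : ℝ) / 8 ≤ d + 1 := by linarith
        nlinarith
      _ ≤ _ := mul_le_mul_of_nonneg_right hHs (by linarith)
  -- At most `n ^ (1/4)` processing elements evaluate more than `T = n ^ (3/4)` outputs. Since `n /
  -- q < √n`, `T` still exceeds `n / q` by the factor `n ^ (1/4) ≥ m / 8`.
  set T := (2 : ℝ) ^ ((3 / 4 : ℝ) * m) with hT
  have hT0 : 0 < T := by positivity
  have hT4 : T * (2 : ℝ) ^ ((m : ℝ) / 4) = (2 : ℝ) ^ m := by
    rw [hT, ← Real.rpow_add (by norm_num), ← Real.rpow_natCast]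
    congr 1; ring
  set o : Fin (2 ^ a) → ℕ := fun P =>
    (Finset.univ.filter fun w : Fin (2 ^ m) => ev (w, Fin.last m) = P).card with ho
  set B : Finset (Fin (2 ^ a)) := Finset.univ.filter fun P => T < (o P : ℝ) with hB
  set G : Finset (Fin (2 ^ m)) := Finset.univ.filter fun w => ev (w, Fin.last m) ∉ B with hG
  rcases le_or_gt (G.card : ℝ) (θ * (2 : ℝ) ^ m) with hGc | hGc
  · -- few processing elements evaluate most outputs
    have hBc : (B.card : ℝ) ≤ (2 : ℝ) ^ ((m : ℝ) / 4) := by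
      have h1 : ∑ P, o P = 2 ^ m := by
        have := Finset.card_eq_sum_card_fiberwise (s := (Finset.univ : Finset (Fin (2 ^ m))))
          (t := (Finset.univ : Finset (Fin (2 ^ a)))) (f := fun w => ev (w, Fin.last m))
          (fun _ _ => Finset.mem_coe.2 (Finset.mem_univ _))
        rw [Finset.card_univ, Fintype.card_fin] at this
        exact this.symm
      have h2 : (B.card : ℝ) * T ≤ (2 : ℝ) ^ m := by
        calc (B.card : ℝ) * T = ∑ _P ∈ B, T := by simp
          _ ≤ ∑ P ∈ B, (o P : ℝ) := Finset.sum_le_sum fun P hP => (Finset.mem_filter.1 hP).2.le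
          _ ≤ ∑ P, (o P : ℝ) := Finset.sum_le_sum_of_subset_of_nonneg (Finset.subset_univ _)
              fun _ _ _ => Nat.cast_nonneg _
          _ = (2 : ℝ) ^ m := by exact_mod_cast h1
      rw [← hT4, mul_comm] at h2
      exact le_of_mul_le_mul_left h2 hT0
    have hH1 : θ * T ≤ H := by
      have hr : (1 : ℝ) ≤ (2 : ℝ) ^ ((m : ℝ) / 4) :=
        Real.one_le_rpow (by norm_num) (by positivity)
      have hθT : 0 < θ * T := by positivity
      rcases h.concentrated hm hθ B hGc with h1 | h1
      · rw [← hT4] at h1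
        have : θ * T ≤ θ * T * (2 : ℝ) ^ ((m : ℝ) / 4) := le_mul_of_one_le_right hθT.le hr
        linarith
      · rw [← hT4] at h1
        have h2 := mul_le_mul_of_nonneg_right hBc hH0
        have h3 : (2 : ℝ) ^ ((m : ℝ) / 4) * (θ * T) ≤ (2 : ℝ) ^ ((m : ℝ) / 4) * H := by linarith
        exact le_of_mul_le_mul_left h3 (by linarith)
    have hsT : s * (2 : ℝ) ^ ((m : ℝ) / 4) ≤ T := by
      rw [hs, hT, ← Real.rpow_natCast, ← Real.rpow_add (by norm_num)]
      refine Real.rpow_le_rpow_of_exponent_le (by norm_num) ?_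
      have h1 : (m : ℝ) < 2 * a := by exact_mod_cast h2a
      rw [← hd, hda]
      linarith
    calc _ ≤ θ / 8 * (s * m) := mul_le_mul_of_nonneg_right hlc1 hsm
      _ = θ * (s * ((m : ℝ) / 8)) := by ring
      _ ≤ θ * (s * (2 : ℝ) ^ ((m : ℝ) / 4)) := by
        gcongr
        exact le_two_rpow_quarter m
      _ ≤ θ * T := mul_le_mul_of_nonneg_left hsT hθ0.le
      _ ≤ H := hH1
      _ ≤ H * (d + 1) := le_mul_of_one_le_right hH0 (by linarith)
  · have hGT : ∀ P, ((G.filter fun w => ev (w, Fin.last m) = P).card : ℝ) ≤ T := fun P => by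
      by_cases hP : P ∈ B
      · have : (G.filter fun w => ev (w, Fin.last m) = P) = ∅ := by
          refine Finset.filter_eq_empty_iff.2 fun w hw hwP => ?_
          exact (Finset.mem_filter.1 hw).2 (hwP ▸ hP)
        rw [this]
        simpa using hT0.le
      · have h1 : (o P : ℝ) ≤ T := by simpa [hB] using hP
        refine le_trans ?_ h1
        rw [Nat.cast_le]
        exact Finset.card_le_card (Finset.filter_subset_filter _ (Finset.subset_univ _))
    -- With `σ = s = n / q` and `x = H / (θ s)`, taking logarithms yields `(m / 4) log 2 ≤ Λ + d x
    -- log 2 + θ x`. As `x ≥ 1`, the right-hand side is at most `x (Λ + 1) (d + 1)`.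
    have h1 := h.spread_bound hm hθ0 hs1 G hGc.le hGT
    have h2 := Real.log_le_log (by positivity) h1
    rw [Real.log_mul (by positivity) (by positivity), Real.log_mul (by positivity) (by positivity),
      Real.log_mul (by positivity) (by positivity), Real.log_exp, Real.log_exp, Real.log_pow, hT,
      Real.log_rpow (by norm_num), hs, Real.log_pow, ← hs, ← hd, ← hH] at h2
    have h3 : d * Real.log 2 * ((2 : ℝ) ^ a * H) / (θ * (2 : ℝ) ^ m) =
        d * Real.log 2 * (H / (θ * s)) := by
      rw [hsq]; field_simp
    have h4 : Real.log θ = -Λ := by rw [hΛ, one_div, Real.log_inv, neg_neg]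
    set x := H / (θ * s) with hx
    have hx1 : 1 ≤ x := by rw [hx, le_div_iff₀ (by positivity)]; linarith
    have h5 : H / s = θ * x := by rw [hx]; field_simp
    have hHx : H = θ * s * x := by rw [hx]; field_simp
    rw [h3, h4, h5] at h2
    have hl2 := Real.log_two_gt_d9
    have hl2' := Real.log_two_lt_d9
    have h6 : (m : ℝ) / 8 ≤ x * (Λ + 1) * (d + 1) := by
      have hx0 : 0 ≤ x := by linarith
      have h7 : (m : ℝ) * (1 / 2) ≤ m * Real.log 2 :=
        mul_le_mul_of_nonneg_left (by linarith) hm0.le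
      have h8 : Λ ≤ x * Λ := le_mul_of_one_le_left hΛ0 hx1
      have h9 : d * Real.log 2 * x ≤ d * 1 * x :=
        mul_le_mul_of_nonneg_right (mul_le_mul_of_nonneg_left (by linarith) hd0) hx0
      have h10 : θ * x ≤ x := mul_le_of_le_one_left hx0 (by linarith)
      have h11 : 0 ≤ x * Λ * d := mul_nonneg (mul_nonneg hx0 hΛ0) hd0
      have h12 : x * (Λ + 1) * (d + 1) = x * Λ * d + x * Λ + d * 1 * x + x := by ring
      linarith
    rw [hlc, div_mul_eq_mul_div, div_le_iff₀ (by linarith), hHx]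
    have h7 : 0 < θ * s := by positivity
    calc θ * (s * m) = 8 * (θ * s) * (m / 8) := by ring
      _ ≤ 8 * (θ * s) * (x * (Λ + 1) * (d + 1)) := mul_le_mul_of_nonneg_left h6 (by linarith)
      _ = _ := by ring


/-! ### Folding -/

theorem foldIdx_foldIdx {a b c : ℕ} (h : b ≤ a) (h' : c ≤ b) (r : Fin (2 ^ a)) :
    foldIdx h' (foldIdx h r) = foldIdx (h'.trans h) r := by
  apply Fin.ext
  simp only [foldIdx]
  rw [Nat.div_div_eq_div_mul, ← pow_add]
  congr 2
  omega

theorem card_foldIdx_fiber {a b : ℕ} (h : b ≤ a) (P : Fin (2 ^ b)) :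
    (Finset.univ.filter fun r : Fin (2 ^ a) => foldIdx h r = P).card = 2 ^ (a - b) := by
  have e : 2 ^ a = 2 ^ b * 2 ^ (a - b) := by rw [← pow_add, Nat.add_sub_cancel' h]
  have h0 : 0 < 2 ^ (a - b) := by positivity
  rw [← Fintype.card_fin (2 ^ (a - b)), ← Finset.card_univ]
  symm
  refine Finset.card_bij (fun (i : Fin (2 ^ (a - b))) _ =>
    (⟨P * 2 ^ (a - b) + i, ?_⟩ : Fin (2 ^ a))) ?_ ?_ ?_
  · calc (P : ℕ) * 2 ^ (a - b) + i < (P + 1) * 2 ^ (a - b) := by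
          have := i.isLt
          rw [add_mul, one_mul]; omega
      _ ≤ 2 ^ b * 2 ^ (a - b) := Nat.mul_le_mul_right _ P.isLt
      _ = 2 ^ a := e.symm
  · intro i _
    simp only [Finset.mem_filter, Finset.mem_univ, true_and]
    apply Fin.ext
    simp only [foldIdx]
    rw [mul_comm, Nat.mul_add_div h0, Nat.div_eq_of_lt i.isLt, add_zero]
  · intro i _ j _ hij
    simpa [Fin.ext_iff] using hij
  · intro r hr
    simp only [Finset.mem_filter, Finset.mem_univ, true_and, Fin.ext_iff, foldIdx] at hr
    refine ⟨⟨r % 2 ^ (a - b), Nat.mod_lt _ h0⟩, Finset.mem_univ _, ?_⟩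
    apply Fin.ext
    simp only
    rw [← hr]
    exact Nat.div_add_mod' _ _

/-- The folding of a superstep. -/
def Superstep.fold {m a : ℕ} (s : Superstep m a) {b : ℕ} (h : b ≤ a) : Superstep m b :=
  { label := s.label
    evals := s.evals.map fun e => (foldIdx h e.1, e.2)
    msgs := s.msgs.map fun μ => ⟨foldIdx h μ.src, foldIdx h μ.dst, μ.payload⟩ }

theorem Algorithm.fold_steps {m a b : ℕ} (A : Algorithm m a) (h : b ≤ a) :
    (A.fold h).steps = A.steps.map fun s => s.fold h := rfl

theorem Superstep.fold_fold {m a b c : ℕ} (s : Superstep m a) (h : b ≤ a) (h' : c ≤ b) :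
    (s.fold h).fold h' = s.fold (h'.trans h) := by
  simp [Superstep.fold, foldIdx_foldIdx]

theorem Algorithm.fold_fold {m a b c : ℕ} (A : Algorithm m a) (h : b ≤ a) (h' : c ≤ b) :
    (A.fold h).fold h' = A.fold (h'.trans h) := by
  have h1 : ((A.fold h).fold h').steps = (A.fold (h'.trans h)).steps := by
    simp [Algorithm.fold_steps, Superstep.fold_fold]
  have h2 : ((A.fold h).fold h').inputs = (A.fold (h'.trans h)).inputs := by
    simp [Algorithm.fold, foldIdx_foldIdx]
  cases hA : (A.fold h).fold h'
  cases hB : A.fold (h'.trans h)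
  simp only [hA, hB] at h1 h2
  rw [h1, h2]

/-- Folding merges memories, so whatever was known remains known to the processor that simulates its
holder. -/
theorem Superstep.Legal.fold {m a b : ℕ} {s : Superstep m a} {M : Set (Fin (2 ^ a) × Node m)}
    {N : Set (Fin (2 ^ b) × Node m)} (hs : s.Legal M) (h : b ≤ a)
    (hMN : ∀ e ∈ M, (foldIdx h e.1, e.2) ∈ N) :
    (s.fold h).Legal N ∧ ∀ e ∈ s.afterSync M, (foldIdx h e.1, e.2) ∈ (s.fold h).afterSync N := by
  have h1 : ∀ e ∈ s.afterEvals M, (foldIdx h e.1, e.2) ∈ (s.fold h).afterEvals N := by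
    rintro e (he | he)
    · exact Or.inl (hMN e he)
    · exact Or.inr (Multiset.mem_map.2 ⟨e, he, rfl⟩)
  refine ⟨⟨?_, ?_, ?_⟩, ?_⟩
  · intro e he u hu
    obtain ⟨e', he', rfl⟩ := Multiset.mem_map.1 he
    exact h1 _ (hs.operands e' he' u hu)
  · intro μ hμ u hu
    obtain ⟨μ', hμ', rfl⟩ := Multiset.mem_map.1 hμ
    exact h1 (μ'.src, u) (hs.payloads μ' hμ' u hu)
  · intro μ hμ
    obtain ⟨μ', hμ', rfl⟩ := Multiset.mem_map.1 hμ
    have h2 := hs.clusters μ' hμ'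
    -- The last exponent is nonzero only if the label exceeds `b`, where subtraction truncates: the
    -- clusters of the folding are then single processors, at least as large as the original
    -- clusters.
    have e1 : 2 ^ (a - b) * 2 ^ (b - s.label) =
        2 ^ (a - s.label) * 2 ^ ((a - b) + (b - s.label) - (a - s.label)) := by
      rw [← pow_add, ← pow_add]; congr 1; omega
    simp only [Superstep.fold, foldIdx]
    rw [Nat.div_div_eq_div_mul, Nat.div_div_eq_div_mul, e1, ← Nat.div_div_eq_div_mul,
      ← Nat.div_div_eq_div_mul, h2]
  · rintro e (he | ⟨μ, hμ, hd, hp⟩)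
    · exact Or.inl (h1 e he)
    · exact Or.inr ⟨_, Multiset.mem_map.2 ⟨μ, hμ, rfl⟩, congrArg (foldIdx h) hd, hp⟩

theorem LegalFrom.fold {m a b : ℕ} (h : b ≤ a) (L : List (Superstep m a)) :
    ∀ (M : Set (Fin (2 ^ a) × Node m)) (N : Set (Fin (2 ^ b) × Node m)), LegalFrom M L →
      (∀ e ∈ M, (foldIdx h e.1, e.2) ∈ N) → LegalFrom N (L.map fun s => s.fold h) := by
  induction L with
  | nil => intro M N _ _; trivial
  | cons s L ih =>
    intro M N hL hMN
    obtain ⟨h1, h2⟩ := hL.1.fold h hMN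
    exact ⟨h1, ih _ _ hL.2 h2⟩

theorem Algorithm.evals_fold {m a b : ℕ} (A : Algorithm m a) (h : b ≤ a) :
    (A.fold h).evals = A.evals.map fun e => (foldIdx h e.1, e.2) := by
  simp only [Algorithm.evals, Algorithm.fold_steps]
  generalize A.steps = L
  induction L with
  | nil => rfl
  | cons s L ih =>
    simp only [List.map_cons, List.sum_cons, Multiset.map_add, ih]
    rfl

/-- Admissibility, apart from the load, is inherited by foldings. -/
theorem Algorithm.admissible_fold {ε : ℝ} {m a b : ℕ} {A : Algorithm m a} (h : b ≤ a)
    (legal : LegalFrom A.initialMemory A.steps) (input_nodes : ∀ e ∈ A.evals, e.2.2 ≠ 0)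
    (eval_once : ∀ v : Node m, v.2 ≠ 0 → A.evals.countP (fun e => e.2 = v) = 1)
    (input_once : ∀ w : Fin (2 ^ m), A.inputs.countP (fun e => e.2 = w) = 1)
    (load : ∀ P : Fin (2 ^ b),
      (A.evals.countP (fun e => foldIdx h e.1 = P) : ℝ) ≤ ε * ((2 : ℝ) ^ m * (m : ℝ))) :
    Admissible ε (A.fold h) where
  legal := by
    rw [Algorithm.fold_steps]
    refine LegalFrom.fold h A.steps A.initialMemory _ legal ?_
    rintro ⟨P, v⟩ ⟨w, hw, rfl⟩
    exact ⟨w, Multiset.mem_map.2 ⟨_, hw, rfl⟩, rfl⟩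
  input_nodes := by
    rw [Algorithm.evals_fold]
    intro e he
    obtain ⟨e', he', rfl⟩ := Multiset.mem_map.1 he
    exact input_nodes e' he'
  eval_once v hv := by
    rw [Algorithm.evals_fold, Multiset.countP_map, ← Multiset.countP_eq_card_filter]
    exact eval_once v hv
  input_once w := by
    simp only [Algorithm.fold]
    rw [Multiset.countP_map, ← Multiset.countP_eq_card_filter]
    exact input_once w
  load P := by
    rw [Algorithm.evals_fold, Multiset.countP_map, ← Multiset.countP_eq_card_filter]
    exact load P

/-- Each processor takes over the traffic of `2 ^ (a - b)` processing elements; messages that become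
internal are no longer counted. -/
theorem degree_fold_le {m a b : ℕ} (s : Superstep m a) (h : b ≤ a) :
    (s.fold h).degree ≤ 2 ^ (a - b) * s.degree := by
  refine Finset.sup_le fun P _ => max_le ?_ ?_
  · simp only [Superstep.sent, Superstep.fold]
    rw [Multiset.countP_map, ← Multiset.countP_eq_card_filter, ← sum_countP_fiber Message.src]
    calc _ ≤ ∑ Q, if foldIdx h Q = P then s.degree else 0 := Finset.sum_le_sum fun Q _ => by
          split_ifs with hQ
          · refine le_trans (countP_mono _ ?_) (sent_le_degree s Q)
            rintro μ _ ⟨rfl, -, h2⟩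
            exact ⟨rfl, fun h3 => h2 (by rw [h3, hQ])⟩
          · refine le_of_eq (Multiset.countP_eq_zero.2 ?_)
            rintro μ _ ⟨rfl, h2, -⟩
            exact hQ h2
      _ = _ := by rw [← Finset.sum_filter, Finset.sum_const, card_foldIdx_fiber, smul_eq_mul]
  · simp only [Superstep.received, Superstep.fold]
    rw [Multiset.countP_map, ← Multiset.countP_eq_card_filter, ← sum_countP_fiber Message.dst]
    calc _ ≤ ∑ Q, if foldIdx h Q = P then s.degree else 0 := Finset.sum_le_sum fun Q _ => by
          split_ifs with hQ
          · refine le_trans (countP_mono _ ?_) (received_le_degree s Q)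
            rintro μ _ ⟨rfl, -, h2⟩
            exact ⟨rfl, fun h3 => h2 (by rw [h3, hQ])⟩
          · refine le_of_eq (Multiset.countP_eq_zero.2 ?_)
            rintro μ _ ⟨rfl, h2, -⟩
            exact hQ h2
      _ = _ := by rw [← Finset.sum_filter, Finset.sum_const, card_foldIdx_fiber, smul_eq_mul]

/-! ### Cumulative degrees -/

/-- Sum of the degrees of the `i`-supersteps of a list. -/
def degreeOf {m a : ℕ} (L : List (Superstep m a)) (i : ℕ) : ℕ :=
  ((L.filter fun s => s.label = i).map Superstep.degree).sum

theorem degreeOf_cons {m a : ℕ} (s : Superstep m a) (L : List (Superstep m a)) (i : ℕ) :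
    degreeOf (s :: L) i = (if s.label = i then s.degree else 0) + degreeOf L i := by
  unfold degreeOf
  by_cases h : s.label = i <;> simp [h]

theorem degreeOf_fold_le {m a b : ℕ} (L : List (Superstep m a)) (h : b ≤ a) (i : ℕ) :
    degreeOf (L.map fun s => s.fold h) i ≤ 2 ^ (a - b) * degreeOf L i := by
  induction L with
  | nil => simp [degreeOf]
  | cons s L ih =>
    rw [List.map_cons, degreeOf_cons, degreeOf_cons, mul_add]
    refine add_le_add ?_ ih
    have : (s.fold h).label = s.label := rfl
    rw [this]
    split_ifs
    · exact degree_fold_le s h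
    · simp

/-- The clusters are single processing elements, so all messages stay at their source. Hence only
labels below `a` contribute to the total degree. -/
theorem degree_eq_zero {m a : ℕ} {s : Superstep m a} {M : Set (Fin (2 ^ a) × Node m)}
    (hs : s.Legal M) (h : a ≤ s.label) : s.degree = 0 := by
  have h1 : ∀ μ ∈ s.msgs, μ.src = μ.dst := fun μ hμ => by
    have := hs.clusters μ hμ
    rw [Nat.sub_eq_zero_of_le h, pow_zero, Nat.div_one, Nat.div_one] at this
    exact Fin.ext this
  refine Nat.le_zero.1 (Finset.sup_le fun P _ => max_le ?_ ?_)
  · refine (Multiset.countP_eq_zero.2 ?_).le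
    rintro μ hμ ⟨rfl, h2⟩
    exact h2 (h1 μ hμ).symm
  · refine (Multiset.countP_eq_zero.2 ?_).le
    rintro μ hμ ⟨rfl, h2⟩
    exact h2 (h1 μ hμ)

theorem totalDegree_eq_sum {m a : ℕ} (L : List (Superstep m a)) :
    ∀ M : Set (Fin (2 ^ a) × Node m), LegalFrom M L →
      totalDegree L = ∑ i ∈ Finset.range a, degreeOf L i := by
  induction L with
  | nil => intro M _; simp [degreeOf]
  | cons s L ih =>
    intro M hL
    simp only [degreeOf_cons, Finset.sum_add_distrib, totalDegree_cons, ← ih _ hL.2]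
    rw [Finset.sum_ite_eq]
    congr 1
    split_ifs with h
    · rfl
    · exact degree_eq_zero hL.1 (by simpa using h)

theorem Admissible.lower_bound {ε : ℝ} (hε : 1 / 2 ≤ ε) (hε' : ε < 1) {m a : ℕ}
    {A : Algorithm m a} (h : Admissible ε A) (ha : 1 ≤ a) (ham : a ≤ m) :
    lowerConst ε * ((2 : ℝ) ^ (m - a) * m) ≤
      (∑ i ∈ Finset.range a, A.cumDegree i : ℕ) * ((m - a : ℕ) + 1 : ℝ) := by
  obtain ⟨own, ev, hp⟩ := h.exists_placement
  have h1 := hp.lower_bound hε hε' ha ham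
  rw [totalDegree_eq_sum A.steps _ h.legal] at h1
  exact h1

theorem InClass.admissible {ε : ℝ} {m a : ℕ} {A : Algorithm m a} (h : InClass ε A) :
    Admissible ε A := by
  cases h; assumption

/-- The lower bound on the partial sums of the cumulative degrees, from the foldings. -/
theorem InClass.lower_bound {ε : ℝ} (hε : 1 / 2 ≤ ε) (hε' : ε < 1) {m b : ℕ}
    {A : Algorithm m b} (h : InClass ε A) (hbm : b ≤ m) {j : ℕ} (hj : 1 ≤ j) (hjb : j ≤ b) :
    lowerConst ε * ((2 : ℝ) ^ (m - b) * m) ≤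
      (∑ i ∈ Finset.range j, (A.cumDegree i : ℝ)) * ((m - j : ℕ) + 1 : ℝ) := by
  have hadm : Admissible ε (A.fold hjb) := by
    -- The class speaks of proper foldings only; for `j = b` the folding is the algorithm itself.
    rcases hjb.lt_or_eq with hlt | rfl
    · cases h with
      | intro _ _ folds => exact (folds j hlt hj).admissible
    · have : A.fold hjb = A := by
        have h1 : ∀ r : Fin (2 ^ j), foldIdx hjb r = r := fun r => by
          apply Fin.ext; simp [foldIdx]
        cases A with
        | mk inputs steps => simp [Algorithm.fold, h1]
      rw [this]
      exact h.admissible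
  have h1 := hadm.lower_bound hε hε' hj (hjb.trans hbm)
  have h2 : ∑ i ∈ Finset.range j, (A.fold hjb).cumDegree i ≤
      2 ^ (b - j) * ∑ i ∈ Finset.range j, A.cumDegree i := by
    rw [Finset.mul_sum]
    exact Finset.sum_le_sum fun i _ => degreeOf_fold_le A.steps hjb i
  have h3 : ((∑ i ∈ Finset.range j, (A.fold hjb).cumDegree i : ℕ) : ℝ) ≤
      (2 : ℝ) ^ (b - j) * ∑ i ∈ Finset.range j, (A.cumDegree i : ℝ) := by exact_mod_cast h2
  have e : (2 : ℝ) ^ (m - j) = (2 : ℝ) ^ (b - j) * (2 : ℝ) ^ (m - b) := by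
    rw [← pow_add]; congr 1; omega
  have h4 : (0 : ℝ) ≤ ((m - j : ℕ) : ℝ) + 1 := by positivity
  have h5 := h1.trans (mul_le_mul_of_nonneg_right h3 h4)
  rw [e] at h5
  refine le_of_mul_le_mul_left (a := (2 : ℝ) ^ (b - j)) ?_ (by positivity)
  linarith

/-! ### Summation by parts -/

/-- Abel summation: replacing each earlier weight by the smallest one, `g j`, can only decrease the
sum, since it acts on nonnegative prefix sums. -/
theorem sum_mul_nonneg_of_partial_sums (d g : ℕ → ℝ) (b : ℕ) (hg : ∀ i < b, 0 ≤ g i)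
    (hg' : ∀ i, i + 1 < b → g (i + 1) ≤ g i)
    (hd : ∀ j ≤ b, 0 ≤ ∑ i ∈ Finset.range j, d i) : 0 ≤ ∑ i ∈ Finset.range b, d i * g i := by
  have key : ∀ j, j < b →
      (∑ i ∈ Finset.range (j + 1), d i) * g j ≤ ∑ i ∈ Finset.range (j + 1), d i * g i := by
    intro j
    induction j with
    | zero => intro _; simp
    | succ j ih =>
      intro hj
      rw [Finset.sum_range_succ, Finset.sum_range_succ (fun i => d i * g i), add_mul]
      refine add_le_add (le_trans ?_ (ih (by omega))) le_rfl
      exact mul_le_mul_of_nonneg_left (hg' j hj) (hd _ (by omega))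
  cases b with
  | zero => simp
  | succ b =>
    exact (mul_nonneg (hd _ le_rfl) (hg b (by omega))).trans (key b (by omega))

theorem sum_mul_le_of_partial_sums {b : ℕ} (x y : ℕ → ℝ) (g : Fin b → ℝ) (hg : ∀ i, 0 ≤ g i)
    (hg' : Antitone g)
    (h : ∀ j, 1 ≤ j → j ≤ b → ∑ i ∈ Finset.range j, x i ≤ ∑ i ∈ Finset.range j, y i) :
    ∑ i : Fin b, x i * g i ≤ ∑ i : Fin b, y i * g i := by
  have h1 := sum_mul_nonneg_of_partial_sums (fun i => y i - x i)
    (fun i => if hi : i < b then g ⟨i, hi⟩ else 0) b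
    (fun i hi => by simp only [hi, dif_pos]; exact hg _)
    (fun i hi => by
      have hi' : i < b := by omega
      simp only [hi, hi', dif_pos]
      exact hg' (Fin.mk_le_mk.2 (Nat.le_succ i)))
    (fun j hj => by
      rcases Nat.eq_zero_or_pos j with rfl | h0
      · simp
      · rw [Finset.sum_sub_distrib]
        linarith [h j h0 hj])
  rw [Finset.sum_range] at h1
  simp only [Fin.is_lt, dif_pos, Fin.eta, sub_mul, Finset.sum_sub_distrib] at h1
  linarith


/-! ### Bit operations on indices -/

/-- Complement the `i`-th bit. -/
def flipBit {N : ℕ} (i : ℕ) (r : Fin (2 ^ N)) : Fin (2 ^ N) := Fin.ofNat (2 ^ N) ((r : ℕ) ^^^ 2 ^ i)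

theorem val_flip {N i : ℕ} (h : i < N) (r : Fin (2 ^ N)) :
    (flipBit i r : ℕ) = (r : ℕ) ^^^ 2 ^ i := by
  simp only [flipBit, Fin.val_ofNat]
  exact Nat.mod_eq_of_lt (Nat.xor_lt_two_pow r.isLt (Nat.pow_lt_pow_right (by norm_num) h))

theorem flip_flip {N i : ℕ} (h : i < N) (r : Fin (2 ^ N)) : flipBit i (flipBit i r) = r := by
  apply Fin.ext
  rw [val_flip h, val_flip h, Nat.xor_assoc, Nat.xor_self, Nat.xor_zero]

theorem testBit_flip {N i : ℕ} (h : i < N) (r : Fin (2 ^ N)) (t : ℕ) :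
    (flipBit i r : ℕ).testBit t = ((r : ℕ).testBit t ^^ decide (i = t)) := by
  rw [val_flip h, Nat.testBit_xor, Nat.testBit_two_pow]

theorem partner_eq_flip (k : ℕ) (r : VP k) : partner k r = flipBit 0 r := by
  simp [partner, flipBit]

/-- Column and row number are the two halves of the low `2 t` bits; transposition exchanges them. -/
theorem testBit_transposeNat (t r i : ℕ) :
    (transposeNat (2 ^ t) r).testBit i =
      if i < t then r.testBit (i + t) else if i < 2 * t then r.testBit (i - t)
        else r.testBit i := by
  have h1 : r % 2 ^ (t + t) / 2 ^ t < 2 ^ t :=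
    Nat.div_lt_of_lt_mul (by rw [← pow_add]; exact Nat.mod_lt _ (by positivity))
  have h2 : r % 2 ^ t < 2 ^ t := Nat.mod_lt _ (by positivity)
  have h3 : 2 ^ t * (r % 2 ^ t) + r % 2 ^ (t + t) / 2 ^ t < 2 ^ (t + t) := by
    calc _ < 2 ^ t * (r % 2 ^ t) + 2 ^ t := Nat.add_lt_add_left h1 _
      _ = 2 ^ t * (r % 2 ^ t + 1) := by ring
      _ ≤ 2 ^ t * 2 ^ t := Nat.mul_le_mul_left _ h2
      _ = 2 ^ (t + t) := (pow_add 2 t t).symm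
  have e : transposeNat (2 ^ t) r = 2 ^ (t + t) * (r / 2 ^ (t + t)) +
      (2 ^ t * (r % 2 ^ t) + r % 2 ^ (t + t) / 2 ^ t) := by
    simp only [transposeNat, ← pow_add]
    ring
  rw [e, Nat.testBit_two_pow_mul_add _ h3, Nat.testBit_two_pow_mul_add _ h1]
  by_cases hi : i < t
  · have h4 : i < t + t := by omega
    have h5 : i + t < t + t := by omega
    simp [hi, h4, h5, Nat.testBit_div_two_pow]
  · by_cases hi2 : i < 2 * t
    · have h4 : i < t + t := by omega
      have h5 : i - t < t := by omega
      simp [hi, hi2, h4, h5]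
    · have h4 : ¬ i < t + t := by omega
      simp only [hi, hi2, h4, if_false, Nat.testBit_div_two_pow]
      congr 1; omega

theorem two_mul_pow_le {k j : ℕ} (hj : j + 1 ≤ k) : 2 * 2 ^ j ≤ 2 ^ k := by
  rw [← pow_succ']; exact Nat.pow_le_pow_right (by norm_num) hj

theorem val_transpose {k j : ℕ} (hj : j + 1 ≤ k) (r : VP k) :
    (transpose k j r : ℕ) = transposeNat (2 ^ 2 ^ j) r := by
  have h0 := two_mul_pow_le hj
  simp only [transpose, Fin.val_ofNat]
  refine Nat.mod_eq_of_lt (Nat.lt_pow_two_of_testBit _ fun i hi => ?_)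
  rw [testBit_transposeNat, if_neg (by omega), if_neg (by omega)]
  exact Nat.testBit_lt_two_pow (r.isLt.trans_le (Nat.pow_le_pow_right (by norm_num) hi))

theorem testBit_transpose {k j : ℕ} (hj : j + 1 ≤ k) (r : VP k) (i : ℕ) :
    (transpose k j r : ℕ).testBit i = if i < 2 ^ j then (r : ℕ).testBit (i + 2 ^ j)
      else if i < 2 * 2 ^ j then (r : ℕ).testBit (i - 2 ^ j) else (r : ℕ).testBit i := by
  rw [val_transpose hj, testBit_transposeNat]

theorem transpose_transpose {k j : ℕ} (hj : j + 1 ≤ k) (r : VP k) :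
    transpose k j (transpose k j r) = r := by
  apply Fin.ext
  apply Nat.eq_of_testBit_eq
  intro i
  simp only [testBit_transpose hj]
  split_ifs <;> first | omega | (congr 1 <;> omega)

theorem transpose_injective {k j : ℕ} (hj : j + 1 ≤ k) : Function.Injective (transpose k j) :=
  (show Function.Involutive (transpose k j) from transpose_transpose hj).injective

theorem transpose_flip_low {k j : ℕ} (hj : j + 1 ≤ k) {i : ℕ} (hi : i < 2 ^ j) (r : VP k) :
    transpose k j (flipBit i r) = flipBit (i + 2 ^ j) (transpose k j r) := by
  have h0 := two_mul_pow_le hj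
  apply Fin.ext
  apply Nat.eq_of_testBit_eq
  intro t
  rw [testBit_flip (by omega)]
  simp only [testBit_transpose hj, testBit_flip (show i < 2 ^ k by omega)]
  split_ifs <;> congr 2 <;> simp only [eq_iff_iff] <;> omega

theorem transpose_flip_high {k j : ℕ} (hj : j + 1 ≤ k) {i : ℕ} (hi : 2 * 2 ^ j ≤ i)
    (hik : i < 2 ^ k) (r : VP k) :
    transpose k j (flipBit i r) = flipBit i (transpose k j r) := by
  apply Fin.ext
  apply Nat.eq_of_testBit_eq
  intro t
  rw [testBit_flip hik]
  simp only [testBit_transpose hj, testBit_flip hik]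
  split_ifs <;> congr 2 <;> simp only [eq_iff_iff] <;> omega

theorem transpose_div {k j : ℕ} (hj : j + 1 ≤ k) (r : VP k) :
    (transpose k j r : ℕ) / 2 ^ 2 ^ (j + 1) = (r : ℕ) / 2 ^ 2 ^ (j + 1) := by
  apply Nat.eq_of_testBit_eq
  intro i
  have : 2 ^ (j + 1) = 2 * 2 ^ j := pow_succ' 2 j
  rw [Nat.testBit_div_two_pow, Nat.testBit_div_two_pow, testBit_transpose hj,
    if_neg (by omega), if_neg (by omega)]

/-! ### The wires held by the virtual processors -/

/-- The segments of `2 ^ 2 ^ j` virtual processors hold the inputs, at level `l`, of subDAGs. -/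
def Aligned (k j : ℕ) (W : VP k → VP k) (l : ℕ) : Prop :=
  ∀ i < 2 ^ j, ∀ r, W (flipBit i r) = flipBit (l + i) (W r)

/-- A segment of size `2 ^ 2 ^ j` uses index bits below `2 ^ j` only, so all segments permute their
wires alike and a relation tied to a higher index bit survives. -/
theorem wiresAfter_flip {k i z : ℕ} (hik : i < 2 ^ k) (j : ℕ) :
    ∀ W : VP k → VP k, j ≤ k → 2 ^ j ≤ i → (∀ r, W (flipBit i r) = flipBit z (W r)) →
      ∀ r, wiresAfter k j W (flipBit i r) = flipBit z (wiresAfter k j W r) := by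
  induction j with
  | zero => intro W _ _ hW; exact hW
  | succ j ih =>
    intro W hj hi hW
    have h2 : 2 ^ (j + 1) = 2 * 2 ^ j := pow_succ' 2 j
    refine ih _ (by omega) (by omega) fun r => ?_
    simp only [Function.comp]
    rw [transpose_flip_high hj (by omega) hik]
    exact ih W (by omega) (by omega) hW _

theorem Aligned.first {k j : ℕ} {W : VP k → VP k} {l : ℕ} (h : Aligned k (j + 1) W l) :
    Aligned k j W l :=
  fun i hi => h i (hi.trans (Nat.pow_lt_pow_right (by norm_num) (Nat.lt_succ_self j)))

/-- Transposition moves index bits `2 ^ j + i` to the low positions. These bits were untouched by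
the first set of subDAGs and govern wire bits `l + 2 ^ j + i`, as the second set requires. -/
theorem Aligned.second {k j : ℕ} (hj : j + 1 ≤ k) {W : VP k → VP k} {l : ℕ}
    (h : Aligned k (j + 1) W l) :
    Aligned k j (wiresAfter k j W ∘ transpose k j) (l + 2 ^ j) := by
  intro i hi r
  have h0 := two_mul_pow_le hj
  have h2 : 2 ^ (j + 1) = 2 * 2 ^ j := pow_succ' 2 j
  simp only [Function.comp]
  rw [transpose_flip_low hj hi, add_assoc, add_comm (2 ^ j) i]
  exact wiresAfter_flip (by omega) j W (by omega) (by omega) (h _ (by omega)) _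

theorem wiresAfter_injective {k : ℕ} (j : ℕ) : ∀ W : VP k → VP k, j ≤ k →
    Function.Injective W → Function.Injective (wiresAfter k j W) := by
  induction j with
  | zero => intro W _ h; exact h
  | succ j ih =>
    intro W hj h
    exact ih _ (by omega) ((ih W (by omega) h).comp (transpose_injective hj))

/-! ### The algorithm is executable -/

/-- Each virtual processor `r` holds the value of the vertex on wire `W r` at level `l`. -/
def Holds (k : ℕ) (W : VP k → VP k) (l : ℕ) (M : Set (VP k × Node (2 ^ k))) : Prop :=
  ∀ r, (r, node k (W r) l) ∈ M

theorem Holds.afterSync {k l : ℕ} {W : VP k → VP k} {M : Set (VP k × Node (2 ^ k))}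
    (h : Holds k W l M) (s : Superstep (2 ^ k) (2 ^ k)) : Holds k W l (s.afterSync M) :=
  fun r => Or.inl (Or.inl (h r))

theorem segLabel_compl {k j : ℕ} (hj : j ≤ k) : 2 ^ k - segLabel k j = 2 ^ j := by
  have : 2 ^ j ≤ 2 ^ k := Nat.pow_le_pow_right (by norm_num) hj
  exact Nat.sub_sub_self this

theorem pow_half_add_half (j : ℕ) : 2 ^ 2 ^ j / 2 + 2 ^ 2 ^ j / 2 = 2 ^ 2 ^ j := by
  obtain ⟨c, hc⟩ : ∃ c, 2 ^ j = c + 1 := ⟨2 ^ j - 1, by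
    have : 0 < 2 ^ j := by positivity
    omega⟩
  rw [hc, pow_succ]
  omega

theorem pow_pow_le {k j : ℕ} (hj : j ≤ k) : 2 ^ 2 ^ j ≤ 2 ^ 2 ^ k :=
  Nat.pow_le_pow_right (by norm_num) (Nat.pow_le_pow_right (by norm_num) hj)

theorem val_dummy_dst {k j : ℕ} (hj : j ≤ k) {r : VP k} (hr : (r : ℕ) < 2 ^ 2 ^ j / 2) :
    (Fin.ofNat (2 ^ 2 ^ k) ((r : ℕ) + 2 ^ 2 ^ j / 2) : ℕ) = (r : ℕ) + 2 ^ 2 ^ j / 2 := by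
  have h1 := pow_half_add_half j
  have h2 := pow_pow_le hj
  rw [Fin.val_ofNat]
  exact Nat.mod_eq_of_lt (by omega)

theorem mem_dummies {k j : ℕ} (hj : j ≤ k) {μ : Message (2 ^ k) (2 ^ k)} (hμ : μ ∈ dummies k j) :
    μ.payload = none ∧ (μ.src : ℕ) / 2 ^ 2 ^ j = (μ.dst : ℕ) / 2 ^ 2 ^ j := by
  obtain ⟨r, hr, rfl⟩ := Multiset.mem_map.1 hμ
  have hr' : (r : ℕ) < 2 ^ 2 ^ j / 2 := by simpa using hr
  have h1 := pow_half_add_half j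
  refine ⟨rfl, ?_⟩
  simp only
  rw [val_dummy_dst hj hr', Nat.div_eq_of_lt (by omega), Nat.div_eq_of_lt (by omega)]

theorem legal_moves {k j l : ℕ} (hj : j ≤ k) {W : VP k → VP k} {M : Set (VP k × Node (2 ^ k))}
    (h : Holds k W l M) (f : VP k → VP k)
    (hf : ∀ r : VP k, (r : ℕ) / 2 ^ 2 ^ j = (f r : ℕ) / 2 ^ 2 ^ j) :
    Superstep.Legal ⟨segLabel k j, 0, moves k W l f + dummies k j⟩ M where
  operands := by simp
  payloads μ hμ u hu := by
    rcases Multiset.mem_add.1 hμ with hμ | hμ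
    · obtain ⟨r, -, rfl⟩ := Multiset.mem_map.1 hμ
      simp only [Option.some.injEq] at hu
      subst hu
      exact Or.inl (h r)
    · rw [(mem_dummies hj hμ).1] at hu
      cases hu
  clusters μ hμ := by
    simp only [segLabel_compl hj]
    rcases Multiset.mem_add.1 hμ with hμ | hμ
    · obtain ⟨r, -, rfl⟩ := Multiset.mem_map.1 hμ
      exact hf r
    · exact (mem_dummies hj hμ).2

theorem received_of_moves {k lab l : ℕ} {W f : VP k → VP k} {D : Multiset (Message (2 ^ k) (2 ^ k))}
    {M : Set (VP k × Node (2 ^ k))} (r : VP k) :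
    (f r, node k (W r) l) ∈ Superstep.afterSync ⟨lab, 0, moves k W l f + D⟩ M :=
  Or.inr ⟨⟨r, f r, some (node k (W r) l)⟩,
    Multiset.mem_add.2 (Or.inl (Multiset.mem_map.2 ⟨r, Finset.mem_univ r, rfl⟩)), rfl, rfl⟩

theorem node_level {k l : ℕ} (hl : l ≤ 2 ^ k) (w : VP k) : ((node k w l).2 : ℕ) = l := by
  simp only [node, Fin.val_ofNat]
  exact Nat.mod_eq_of_lt (by omega)

theorem partner_div (k : ℕ) (r : VP k) :
    (r : ℕ) / 2 ^ 2 ^ 0 = (partner k r : ℕ) / 2 ^ 2 ^ 0 := by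
  have h0 : 0 < 2 ^ k := by positivity
  rw [partner_eq_flip]
  apply Nat.eq_of_testBit_eq
  intro i
  rw [Nat.testBit_div_two_pow, Nat.testBit_div_two_pow, testBit_flip h0]
  simp

/-- The predecessors lie on the wire `W r` and on the wire differing from it in bit `l`; by
alignment the latter is the wire of the partner. -/
theorem legal_evalStep {k l : ℕ} (hl : l + 1 ≤ 2 ^ k) {W : VP k → VP k}
    (hW : ∀ r, W (flipBit 0 r) = flipBit l (W r)) {M : Set (VP k × Node (2 ^ k))}
    (h : Holds k W l M) (h' : Holds k (W ∘ partner k) l M) : (evalStep k W l).Legal M where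
  operands e he u hu := by
    have he' : e ∈ (Finset.univ : Finset (VP k)).val.map
      fun r => (r, node k (W r) (l + 1)) := he
    obtain ⟨r, -, rfl⟩ := Multiset.mem_map.1 he'
    obtain ⟨h1, h2⟩ := hu
    rw [node_level hl] at h1
    have hul : (u.2 : ℕ) = l := by omega
    have hu2 : ∀ w, u.1 = w → u = node k w l := fun w hw =>
      Prod.ext hw (Fin.ext (by rw [node_level (by omega), hul]))
    refine Or.inl ?_
    rcases h2 with h2 | h2
    · rw [hu2 (W r) h2]
      exact h r
    · have h3 : u.1 = W (partner k r) := by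
        rw [partner_eq_flip, hW]
        apply Fin.ext
        rw [val_flip (by omega), ← hul, ← h2, Nat.xor_comm, Nat.xor_assoc]
        simp [node]
      rw [hu2 _ h3]
      exact h' r
  payloads μ hμ u hu := by
    rw [(mem_dummies (Nat.zero_le k) hμ).1] at hu
    cases hu
  clusters μ hμ := by
    simp only [evalStep, segLabel_compl (Nat.zero_le k)]
    exact (mem_dummies (Nat.zero_le k) hμ).2

/-- The arbitrary continuation `L` makes the recursion compose: `Holds` is all that needs to be
known about the memories between the parts. -/
theorem legalFrom_fftSteps (k j : ℕ) : ∀ (W : VP k → VP k) (l : ℕ)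
    (M : Set (VP k × Node (2 ^ k))) (L : List (Superstep (2 ^ k) (2 ^ k))), j ≤ k →
    l + 2 ^ j ≤ 2 ^ k → Aligned k j W l → Holds k W l M →
    (∀ N, Holds k (wiresAfter k j W) (l + 2 ^ j) N → LegalFrom N L) →
    LegalFrom M (fftSteps k j W l ++ L) := by
  induction j with
  | zero =>
    intro W l M L _ hl hA hM hL
    have hp : ∀ r, partner k (partner k r) = r := fun r => by
      rw [partner_eq_flip, partner_eq_flip, flip_flip (by positivity)]
    refine ⟨legal_moves (Nat.zero_le k) hM _ (partner_div k), legal_evalStep hl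
      (fun r => hA 0 (by norm_num) r) (hM.afterSync _) (fun r => ?_), hL _ fun r => ?_⟩
    · have := received_of_moves (lab := segLabel k 0) (l := l) (W := W) (f := partner k)
        (D := dummies k 0) (M := M) (partner k r)
      rw [hp] at this
      exact this
    · have : (r, node k (W r) (l + 1)) ∈ (Finset.univ : Finset (VP k)).val.map
        fun r => (r, node k (W r) (l + 1)) := Multiset.mem_map.2 ⟨r, Finset.mem_univ r, rfl⟩
      exact Or.inl (Or.inr this)
  | succ j ih =>
    intro W l M L hj hl hA hM hL
    have h2 : 2 ^ (j + 1) = 2 ^ j + 2 ^ j := by rw [pow_succ]; omega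
    have h0 : 0 < 2 ^ j := by positivity
    simp only [fftSteps, List.append_assoc, List.singleton_append]
    refine ih W l M _ (by omega) (by omega) hA.first hM fun N hN => ?_
    refine ⟨legal_moves hj hN _ fun r => (transpose_div hj r).symm, ?_⟩
    refine ih _ _ _ L (by omega) (by omega) (hA.second hj) (fun r => ?_) ?_
    · have := received_of_moves (lab := segLabel k (j + 1)) (l := l + 2 ^ j)
        (W := wiresAfter k j W) (f := transpose k j) (D := dummies k (j + 1)) (M := N)
        (transpose k j r)
      rw [transpose_transpose hj] at this
      exact this
    · rw [add_assoc, ← h2]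
      exact hL

theorem legalFrom_fftAlgorithm (k : ℕ) :
    LegalFrom (fftAlgorithm k).initialMemory (fftAlgorithm k).steps := by
  have := legalFrom_fftSteps k k id 0 (fftAlgorithm k).initialMemory [] le_rfl (by simp)
    (fun i _ r => by simp) (fun r => ?_) (fun _ _ => trivial)
  · rwa [List.append_nil] at this
  · have : (r, r) ∈ (Finset.univ : Finset (VP k)).val.map fun r => (r, r) :=
      Multiset.mem_map.2 ⟨r, Finset.mem_univ r, rfl⟩
    exact ⟨r, this, rfl⟩

/-! ### Evaluations -/

theorem countP_univ_map {α β : Type*} [Fintype α] (f : α → β) (p : β → Prop) [DecidablePred p] :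
    ((Finset.univ : Finset α).val.map f).countP p =
      (Finset.univ.filter fun r => p (f r)).card := by
  rw [Multiset.countP_map]; rfl

/-- The call covers the levels `l + 1, ..., l + 2 ^ j`, which the recursion halves; on each level,
injectivity of the wire assignment makes every wire occur once. -/
theorem countP_evals_fftSteps_vertex {k : ℕ} (v : Node (2 ^ k)) (j : ℕ) :
    ∀ (W : VP k → VP k) (l : ℕ), j ≤ k → l + 2 ^ j ≤ 2 ^ k → Function.Injective W →
      (((fftSteps k j W l).map Superstep.evals).sum).countP (fun e => e.2 = v) =
        if l < v.2 ∧ (v.2 : ℕ) ≤ l + 2 ^ j then 1 else 0 := by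
  induction j with
  | zero =>
    intro W l _ hl hW
    have hsum : ((fftSteps k 0 W l).map Superstep.evals).sum =
        (Finset.univ : Finset (VP k)).val.map fun r => (r, node k (W r) (l + 1)) := by
      simp [fftSteps, exchangeStep, evalStep]
    rw [hsum, countP_univ_map]
    have hb : Function.Bijective W := Finite.injective_iff_bijective.1 hW
    obtain ⟨r, hr⟩ := hb.2 v.1
    split_ifs with h
    · have h1 : (v.2 : ℕ) = l + 1 := by omega
      rw [Finset.card_eq_one]
      refine ⟨r, ?_⟩
      ext t
      simp only [Finset.mem_filter, Finset.mem_univ, true_and, Finset.mem_singleton]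
      constructor
      · intro ht
        exact hW (((Prod.ext_iff.1 ht).1).trans hr.symm)
      · rintro rfl
        exact Prod.ext hr (Fin.ext (by rw [node_level (show l + 1 ≤ 2 ^ k from hl), h1]))
    · rw [Finset.card_eq_zero, Finset.filter_eq_empty_iff]
      rintro t - ht
      have h1 := congrArg (fun u : Node (2 ^ k) => (u.2 : ℕ)) ht
      simp only [node_level (show l + 1 ≤ 2 ^ k from hl)] at h1
      omega
  | succ j ih =>
    intro W l hj hl hW
    have h2 : 2 ^ (j + 1) = 2 ^ j + 2 ^ j := by rw [pow_succ]; omega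
    have h0 : 0 < 2 ^ j := by positivity
    have hW' := (wiresAfter_injective j W (by omega) hW).comp (transpose_injective hj)
    simp only [fftSteps, List.map_append, List.sum_append, Multiset.countP_add, List.map_cons,
      List.map_nil, List.sum_cons, List.sum_nil, transposeStep, Multiset.countP_zero]
    rw [ih W l (by omega) (by omega) hW, ih _ (l + 2 ^ j) (by omega) (by omega) hW']
    split_ifs <;> omega

theorem countP_evals_fftSteps_proc {k : ℕ} (p : VP k → Prop) [DecidablePred p] (j : ℕ) :
    ∀ (W : VP k → VP k) (l : ℕ),
      (((fftSteps k j W l).map Superstep.evals).sum).countP (fun e => p e.1) =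
        2 ^ j * (Finset.univ.filter p).card := by
  induction j with
  | zero =>
    intro W l
    have hsum : ((fftSteps k 0 W l).map Superstep.evals).sum =
        (Finset.univ : Finset (VP k)).val.map fun r => (r, node k (W r) (l + 1)) := by
      simp [fftSteps, exchangeStep, evalStep]
    rw [hsum, countP_univ_map, pow_zero, one_mul]
  | succ j ih =>
    intro W l
    simp only [fftSteps, List.map_append, List.sum_append, Multiset.countP_add, List.map_cons,
      List.map_nil, List.sum_cons, List.sum_nil, transposeStep, Multiset.countP_zero, ih]
    ring

theorem admissible_fold_fft {ε : ℝ} (hε : 1 / 2 ≤ ε) (k b : ℕ) (hb : 1 ≤ b) (hbk : b ≤ 2 ^ k) :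
    Admissible ε ((fftAlgorithm k).fold hbk) := by
  have once : ∀ v : Node (2 ^ k), (fftAlgorithm k).evals.countP (fun e => e.2 = v) =
      if v.2 ≠ 0 then 1 else 0 := fun v => by
    have h1 := countP_evals_fftSteps_vertex v k id 0 le_rfl (by simp) Function.injective_id
    refine h1.trans ?_
    have h2 := v.2.isLt
    have h3 : v.2 ≠ 0 ↔ 0 < (v.2 : ℕ) := by
      rw [Nat.pos_iff_ne_zero, ne_eq, ne_eq, Fin.ext_iff]; rfl
    simp only [h3]
    congr 1
    simp only [eq_iff_iff]
    omega
  refine Algorithm.admissible_fold hbk (legalFrom_fftAlgorithm k) ?_ ?_ ?_ ?_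
  · intro e he hz
    have h1 := once e.2
    rw [if_neg (not_not.2 hz), Multiset.countP_eq_zero] at h1
    exact h1 e he rfl
  · intro v hv
    rw [once v, if_pos hv]
  · intro w
    simp only [fftAlgorithm]
    rw [countP_univ_map]
    simp [Finset.filter_eq']
  · intro P
    have h1 := countP_evals_fftSteps_proc (fun r : VP k => foldIdx hbk r = P) k id 0
    rw [card_foldIdx_fiber] at h1
    have h2 : (((fftAlgorithm k).evals.countP fun e => foldIdx hbk e.1 = P : ℕ) : ℝ) =
        (2 : ℝ) ^ k * (2 : ℝ) ^ (2 ^ k - b) := by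
      exact_mod_cast h1
    rw [h2]
    -- With at least two processors, each has at most half of the evaluations; this is where `1 / 2
    -- ≤ ε` enters.
    have h3 : (2 : ℝ) ^ (2 ^ k - b) * 2 ≤ (2 : ℝ) ^ 2 ^ k := by
      rw [← pow_succ]
      exact pow_le_pow_right₀ (by norm_num) (by omega)
    push_cast
    have h4 : (0 : ℝ) < (2 : ℝ) ^ k := by positivity
    have h5 : (0 : ℝ) < (2 : ℝ) ^ 2 ^ k := by positivity
    calc (2 : ℝ) ^ k * (2 : ℝ) ^ (2 ^ k - b) ≤ (2 : ℝ) ^ k * (1 / 2 * (2 : ℝ) ^ 2 ^ k) :=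
          mul_le_mul_of_nonneg_left (by linarith) h4.le
      _ ≤ (2 : ℝ) ^ k * (ε * (2 : ℝ) ^ 2 ^ k) :=
          mul_le_mul_of_nonneg_left (mul_le_mul_of_nonneg_right hε h5.le) h4.le
      _ = _ := by ring

theorem inClass_fold_fft {ε : ℝ} (hε : 1 / 2 ≤ ε) (k : ℕ) :
    ∀ (b : ℕ) (_ : 1 ≤ b) (hbk : b ≤ 2 ^ k), InClass ε ((fftAlgorithm k).fold hbk) := by
  intro b
  induction b using Nat.strong_induction_on with
  | _ b ih =>
    intro hb hbk
    refine InClass.intro _ (admissible_fold_fft hε k b hb hbk) fun c hc hc1 => ?_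
    rw [Algorithm.fold_fold]
    exact ih c hc hc1 _

/-! ### Degrees and numbers of supersteps -/

theorem countP_moves_src_le {k : ℕ} (W : VP k → VP k) (l : ℕ) (f : VP k → VP k) (P : VP k) :
    (moves k W l f).countP (fun μ => μ.src = P) ≤ 1 := by
  rw [moves, countP_univ_map]
  simp [Finset.filter_eq']

theorem countP_moves_dst_le {k : ℕ} (W : VP k → VP k) (l : ℕ) {f : VP k → VP k}
    (hf : Function.Injective f) (P : VP k) :
    (moves k W l f).countP (fun μ => μ.dst = P) ≤ 1 := by
  rw [moves, countP_univ_map]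
  refine Finset.card_le_one.2 fun r hr t ht => ?_
  simp only [Finset.mem_filter, Finset.mem_univ, true_and] at hr ht
  exact hf (hr.trans ht.symm)

theorem countP_dummies_src_le (k j : ℕ) (P : VP k) :
    (dummies k j).countP (fun μ => μ.src = P) ≤ 1 := by
  rw [dummies, Multiset.countP_map, ← Finset.filter_val, Finset.card_val]
  refine Finset.card_le_one.2 fun r hr t ht => ?_
  simp only [Finset.mem_filter] at hr ht
  exact hr.2.trans ht.2.symm

theorem countP_dummies_dst_le {k j : ℕ} (hj : j ≤ k) (P : VP k) :
    (dummies k j).countP (fun μ => μ.dst = P) ≤ 1 := by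
  rw [dummies, Multiset.countP_map, ← Finset.filter_val, Finset.card_val]
  refine Finset.card_le_one.2 fun r hr t ht => ?_
  simp only [Finset.mem_filter, Finset.mem_univ, true_and] at hr ht
  have h1 := congrArg Fin.val (hr.2.trans ht.2.symm)
  rw [val_dummy_dst hj hr.1, val_dummy_dst hj ht.1] at h1
  exact Fin.ext (by omega)

theorem degree_le_of_countP {m a : ℕ} {s : Superstep m a} {d : ℕ}
    (h : ∀ P, s.msgs.countP (fun μ => μ.src = P) ≤ d)
    (h' : ∀ P, s.msgs.countP (fun μ => μ.dst = P) ≤ d) : s.degree ≤ d :=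
  Finset.sup_le fun P _ => max_le ((countP_mono _ fun _ _ h => h.1).trans (h P))
    ((countP_mono _ fun _ _ h => h.1).trans (h' P))

theorem degree_moves_le {k j l lab : ℕ} (hj : j ≤ k) (W : VP k → VP k) {f : VP k → VP k}
    (hf : Function.Injective f) (E : Multiset (VP k × Node (2 ^ k))) :
    (Superstep.mk lab E (moves k W l f + dummies k j)).degree ≤ 2 :=
  degree_le_of_countP
    (fun P => by
      rw [Multiset.countP_add]
      exact add_le_add (countP_moves_src_le W l f P) (countP_dummies_src_le k j P))
    (fun P => by
      rw [Multiset.countP_add]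
      exact add_le_add (countP_moves_dst_le W l hf P) (countP_dummies_dst_le hj P))

theorem degree_fftSteps_le (k j : ℕ) : ∀ (W : VP k → VP k) (l : ℕ), j ≤ k →
    ∀ s ∈ fftSteps k j W l, s.degree ≤ 2 := by
  induction j with
  | zero =>
    intro W l _ s hs
    simp only [fftSteps, List.mem_cons, List.not_mem_nil, or_false] at hs
    rcases hs with rfl | rfl
    · refine degree_moves_le (Nat.zero_le k) W (fun r t h => ?_) 0
      rw [partner_eq_flip, partner_eq_flip] at h
      rw [← flip_flip (show 0 < 2 ^ k by positivity) r, h, flip_flip (by positivity)]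
    · exact degree_le_of_countP (fun P => (countP_dummies_src_le k 0 P).trans one_le_two)
        (fun P => (countP_dummies_dst_le (Nat.zero_le k) P).trans one_le_two)
  | succ j ih =>
    intro W l hj s hs
    simp only [fftSteps, List.mem_append, List.mem_singleton] at hs
    rcases hs with (hs | rfl) | hs
    · exact ih _ _ (by omega) s hs
    · exact degree_moves_le hj _ (transpose_injective hj) 0
    · exact ih _ _ (by omega) s hs

/-- The number of supersteps with small labels. -/
theorem countP_label_fftSteps {k i : ℕ} (hi : i ≤ 2 ^ k) (j : ℕ) :
    ∀ (W : VP k → VP k) (l : ℕ), j ≤ k →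
      if 2 ^ k - i + 1 ≤ 2 ^ j then
        ((fftSteps k j W l).countP (fun s => s.label < i) + 1) * (2 ^ k - i + 1) ≤ 4 * 2 ^ j
      else (fftSteps k j W l).countP (fun s => s.label < i) = 0 := by
  -- Only segments with `2 ^ j ≥ log n - i + 1` count. From there on the number `N` of supersteps
  -- obeys `N ↦ 2 N + 1`, so `N + 1` doubles along with `2 ^ j`. The factor 4 covers the start of
  -- the recursion: `N = 1` there, or `N = 2` if it is at `j = 0`.
  have hlab : ∀ j, j ≤ k → (segLabel k j < i ↔ 2 ^ k - i + 1 ≤ 2 ^ j) := fun j hj => by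
    have : 2 ^ j ≤ 2 ^ k := Nat.pow_le_pow_right (by norm_num) hj
    have : 0 < 2 ^ j := by positivity
    unfold segLabel
    omega
  induction j with
  | zero =>
    intro W l hj
    have h1 := hlab 0 hj
    split_ifs with h
    · simp [fftSteps, exchangeStep, evalStep, h1.2 h]
      omega
    · simp only [fftSteps, exchangeStep, evalStep, List.countP_cons, List.countP_nil]
      simp [mt h1.1 h]
  | succ j ih =>
    intro W l hj
    have h1 := hlab (j + 1) hj
    have h2 : 2 ^ (j + 1) = 2 * 2 ^ j := pow_succ' 2 j
    have ih1 := ih W l (by omega)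
    have ih2 := ih (wiresAfter k j W ∘ transpose k j) (l + 2 ^ j) (by omega)
    simp only [fftSteps, List.countP_append, List.countP_singleton, transposeStep,
      decide_eq_true_eq]
    split_ifs at ih1 ih2 with hlow
    · rw [if_pos (by omega)]
      rw [if_pos (h1.2 (by omega))]
      rw [h2]
      nlinarith
    · rw [ih1, ih2]
      by_cases h : 2 ^ k - i + 1 ≤ 2 ^ (j + 1)
      · rw [if_pos h, if_pos (h1.2 h)]
        omega
      · rw [if_neg h, if_neg (mt h1.1 h)]


/-! ### Optimality -/

theorem sum_numSteps {m a : ℕ} (A : Algorithm m a) (j : ℕ) :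
    ∑ i ∈ Finset.range j, A.numSteps i = A.steps.countP fun s => s.label < j := by
  simp only [Algorithm.numSteps]
  generalize A.steps = L
  induction L with
  | nil => simp
  | cons s L ih =>
    have h : ∀ i, ((s :: L).filter fun s => s.label = i).length =
        (if s.label = i then 1 else 0) + (L.filter fun s => s.label = i).length := fun i => by
      by_cases h : s.label = i <;> simp [h, add_comm]
    simp only [h, Finset.sum_add_distrib, ih, Finset.sum_ite_eq, Finset.mem_range,
      List.countP_cons, decide_eq_true_eq]
    rw [add_comm]

theorem cumDegree_le {m a d : ℕ} (A : Algorithm m a) (h : ∀ s ∈ A.steps, s.degree ≤ d) (i : ℕ) :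
    A.cumDegree i ≤ d * A.numSteps i := by
  have := List.sum_le_card_nsmul ((A.steps.filter fun s => s.label = i).map Superstep.degree) d
    (fun n hn => by
      obtain ⟨s, hs, rfl⟩ := List.mem_map.1 hn
      exact h s (List.mem_filter.1 hs).1)
  rw [List.length_map, smul_eq_mul, mul_comm] at this
  exact this

theorem degree_fold_fft_le {k b : ℕ} (hbk : b ≤ 2 ^ k) :
    ∀ s ∈ ((fftAlgorithm k).fold hbk).steps, s.degree ≤ 2 * 2 ^ (2 ^ k - b) := by
  intro s hs
  rw [Algorithm.fold_steps] at hs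
  obtain ⟨t, ht, rfl⟩ := List.mem_map.1 hs
  refine (degree_fold_le t hbk).trans ?_
  rw [mul_comm]
  exact Nat.mul_le_mul_right _ (degree_fftSteps_le k k id 0 le_rfl t ht)

theorem sum_numSteps_fold_fft_le {k b j : ℕ} (hbk : b ≤ 2 ^ k) (hj : 1 ≤ j) (hjk : j ≤ 2 ^ k) :
    (∑ i ∈ Finset.range j, ((fftAlgorithm k).fold hbk).numSteps i) * (2 ^ k - j + 1) ≤
      4 * 2 ^ k := by
  rw [sum_numSteps, Algorithm.fold_steps, List.countP_map]
  have h := countP_label_fftSteps hjk k id 0 le_rfl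
  rw [if_pos (by omega)] at h
  exact (Nat.mul_le_mul_right _ (Nat.le_succ _)).trans h

/-- The communication time of the algorithm, with the latency bounded in terms of `g`. -/
theorem commTime_fold_fft_le {k b : ℕ} (hb : 1 ≤ b) (hbk : b ≤ 2 ^ k) {c : ℝ} {g ℓ : Fin b → ℝ}
    (hg : ∀ i, 0 < g i) (hℓ' : Antitone fun i => ℓ i / g i)
    (hc : ℓ ⟨0, hb⟩ / g ⟨0, hb⟩ ≤ c * ((2 : ℝ) ^ (2 ^ k) / (2 : ℝ) ^ b)) :
    ((fftAlgorithm k).fold hbk).commTime g ℓ ≤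
      ∑ i : Fin b, ((2 + |c|) * (2 : ℝ) ^ (2 ^ k - b) *
        (((fftAlgorithm k).fold hbk).numSteps i : ℝ)) * g i := by
  set A := (fftAlgorithm k).fold hbk
  have e : (2 : ℝ) ^ (2 ^ k) / (2 : ℝ) ^ b = (2 : ℝ) ^ (2 ^ k - b) := by
    rw [div_eq_iff (by positivity), ← pow_add, Nat.sub_add_cancel hbk]
  set s := (2 : ℝ) ^ (2 ^ k - b) with hs
  have hs0 : 0 < s := by positivity
  rw [e] at hc
  refine Finset.sum_le_sum fun i _ => ?_
  have h1 : (A.cumDegree i : ℝ) ≤ 2 * s * A.numSteps i := by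
    rw [hs]
    exact_mod_cast cumDegree_le A (degree_fold_fft_le hbk) i
  -- `ℓ i / g i` is largest at `i = 0`. The absolute value keeps the constant nonnegative whatever
  -- the sign of `c`.
  have h2 : ℓ i ≤ |c| * s * g i := by
    rw [← div_le_iff₀ (hg i)]
    exact (hℓ' (Fin.mk_le_of_le_val (Nat.zero_le _))).trans
      (hc.trans (mul_le_mul_of_nonneg_right (le_abs_self c) hs0.le))
  calc (A.cumDegree i : ℝ) * g i + (A.numSteps i : ℝ) * ℓ i ≤
        2 * s * A.numSteps i * g i + (A.numSteps i : ℝ) * (|c| * s * g i) :=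
      add_le_add (mul_le_mul_of_nonneg_right h1 (hg i).le)
        (mul_le_mul_of_nonneg_left h2 (Nat.cast_nonneg _))
    _ = _ := by ring

theorem commTime_fold_fft_le_mul {ε : ℝ} (hε : 1 / 2 ≤ ε) (hε' : ε < 1) {k b : ℕ} (hb : 1 ≤ b)
    (hbk : b ≤ 2 ^ k) {c : ℝ} {g ℓ : Fin b → ℝ} (hg : ∀ i, 0 < g i) (hℓ : ∀ i, 0 ≤ ℓ i)
    (hg' : Antitone g) (hℓ' : Antitone fun i => ℓ i / g i)
    (hc : ℓ ⟨0, hb⟩ / g ⟨0, hb⟩ ≤ c * ((2 : ℝ) ^ (2 ^ k) / (2 : ℝ) ^ b))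
    {B : Algorithm (2 ^ k) b} (hB : InClass ε B) :
    ((fftAlgorithm k).fold hbk).commTime g ℓ ≤
      4 * (2 + |c|) / lowerConst ε * B.commTime g ℓ := by
  have hlc := lowerConst_pos hε hε'
  set K := 4 * (2 + |c|) / lowerConst ε with hK
  have hK0 : 0 < K := by positivity
  refine (commTime_fold_fft_le hb hbk hg hℓ' hc).trans ?_
  have h1 : ∑ i : Fin b, ((2 + |c|) * (2 : ℝ) ^ (2 ^ k - b) *
        (((fftAlgorithm k).fold hbk).numSteps i : ℝ)) * g i ≤
      ∑ i : Fin b, (K * (B.cumDegree i : ℝ)) * g i := by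
    refine sum_mul_le_of_partial_sums (fun i => (2 + |c|) * (2 : ℝ) ^ (2 ^ k - b) *
        (((fftAlgorithm k).fold hbk).numSteps i : ℝ)) (fun i => K * (B.cumDegree i : ℝ)) g
        (fun i => (hg i).le) hg' fun j hj hjb => ?_
    rw [← Finset.mul_sum, ← Finset.mul_sum]
    have h2 := hB.lower_bound hε hε' hbk hj hjb
    have h3 : (∑ i ∈ Finset.range j, (((fftAlgorithm k).fold hbk).numSteps i : ℝ)) *
        (((2 ^ k - j : ℕ) : ℝ) + 1) ≤ 4 * ((2 ^ k : ℕ) : ℝ) := by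
      exact_mod_cast sum_numSteps_fold_fft_le hbk hj (hjb.trans hbk)
    refine le_of_mul_le_mul_right ?_ (show (0 : ℝ) < ((2 ^ k - j : ℕ) : ℝ) + 1 by positivity)
    calc (2 + |c|) * (2 : ℝ) ^ (2 ^ k - b) *
          (∑ i ∈ Finset.range j, (((fftAlgorithm k).fold hbk).numSteps i : ℝ)) *
          (((2 ^ k - j : ℕ) : ℝ) + 1)
        = (2 + |c|) * (2 : ℝ) ^ (2 ^ k - b) *
          ((∑ i ∈ Finset.range j, (((fftAlgorithm k).fold hbk).numSteps i : ℝ)) *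
          (((2 ^ k - j : ℕ) : ℝ) + 1)) := by ring
      _ ≤ (2 + |c|) * (2 : ℝ) ^ (2 ^ k - b) * (4 * ((2 ^ k : ℕ) : ℝ)) :=
        mul_le_mul_of_nonneg_left h3 (by positivity)
      _ = K * (lowerConst ε * ((2 : ℝ) ^ (2 ^ k - b) * ((2 ^ k : ℕ) : ℝ))) := by
        rw [hK]; field_simp
      _ ≤ K * ((∑ i ∈ Finset.range j, (B.cumDegree i : ℝ)) * (((2 ^ k - j : ℕ) : ℝ) + 1)) :=
        mul_le_mul_of_nonneg_left h2 hK0.le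
      _ = _ := by ring
  refine h1.trans ?_
  rw [Algorithm.commTime, Finset.mul_sum]
  refine Finset.sum_le_sum fun i _ => ?_
  -- The latency of `B` is not needed for the bound and is dropped.
  have : 0 ≤ K * ((B.numSteps i : ℝ) * ℓ i) :=
    mul_nonneg hK0.le (mul_nonneg (Nat.cast_nonneg _) (hℓ i))
  linarith

theorem Algorithm.commTime_nonneg {m a : ℕ} (A : Algorithm m a) {g ℓ : Fin a → ℝ}
    (hg : ∀ i, 0 < g i) (hℓ : ∀ i, 0 ≤ ℓ i) : 0 ≤ A.commTime g ℓ :=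
  Finset.sum_nonneg fun i _ => add_nonneg (mul_nonneg (Nat.cast_nonneg _) (hg i).le)
    (mul_nonneg (Nat.cast_nonneg _) (hℓ i))

end FFTNet

theorem mainTheorem6 (ε : ℝ) (hε : 1 / 2 ≤ ε) (hε' : ε < 1) (c : ℝ) :
    ∃ β : ℝ, 0 < β ∧ β ≤ 1 ∧
      ∀ (k b : ℕ) (hb : 1 ≤ b) (hbk : b ≤ 2 ^ k) (g ℓ : Fin b → ℝ),
        (∀ i, 0 < g i) → (∀ i, 0 ≤ ℓ i) →
        Antitone g → Antitone (fun i => ℓ i / g i) →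
        ℓ ⟨0, hb⟩ / g ⟨0, hb⟩ ≤ c * ((2 : ℝ) ^ (2 ^ k) / (2 : ℝ) ^ b) →
        FFTNet.IsOptimal β ε g ℓ ((FFTNet.fftAlgorithm k).fold hbk) := by
  -- The maximum with 1 ensures `β = 1 / K ≤ 1`.
  set K := max 1 (4 * (2 + |c|) / FFTNet.lowerConst ε)
  have hK : 1 ≤ K := le_max_left _ _
  refine ⟨1 / K, by positivity, by rw [div_le_one (by linarith)]; exact hK, ?_⟩
  intro k b hb hbk g ℓ hg hℓ hg' hℓ' hc
  refine ⟨FFTNet.inClass_fold_fft hε k b hb hbk, fun B hB => ?_⟩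
  rw [one_div_one_div]
  exact (FFTNet.commTime_fold_fft_le_mul hε hε' hb hbk hg hℓ hg' hℓ' hc hB).trans
    (mul_le_mul_of_nonneg_right (le_max_right _ _) (B.commTime_nonneg hg hℓ))
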